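/- Let $m\ge 1$ be an integer, $\mu\in\mathbb R$, and let $w:(0,\infty)\to[0,\infty)$ be a vortex profile: a solution of $$-w''-\tfrac1r w'+\tfrac{m^2}{r^2}w+r^2w+2|w|^2w-2\mu w=0,\qquad r>0,$$ that is bounded as $r\to0^+$ and tends to $0$ as $r\to\infty$. For $j\in\mathbb Z$ and $\lambda\in\mathbb C$ consider the linear system $y'=B(r,j,\lambda)y$ on $(0,\infty)$ for $y=(y_+,y_+',y_-,y_-')^T$, where $$B=\begin{pmatrix}0&1&0&0\\k^+&-1/r&0&0\\0&0&0&1\\0&0&k^-&-1/r\end{pmatrix}+|w|^2\begin{pmatrix}0&0&0&0\\4&0&2&0\\0&0&0&0\\2&0&4&0\end{pmatrix},\qquad k^\pm=\frac{(j\pm m)^2}{r^2}+r^2-2\mu\mp2i\lambda .$$ Let $B^{(2)}$ be the $6\times6$ matrix that $B$ induces on $\Lambda^2\mathbb C^4$, i.e. $B^{(2)}(u\wedge v)=Bu\wedge v+u\wedge Bv$. Put $a=|j+m|$, $b=|j-m|$. Let $\hat y$ be the solution of the exterior system $\hat y'=B^{(2)}\hat y$ on $(0,\infty)$ with $$\hat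 y(r)\sim r^{a+b}\,(1,a/r,0,0)\wedge(0,0,1,b/r)\qquad(r\to0^+),$$ and let $\hat z$ be the solution of the adjoint exterior system $\hat z'=-\hat zB^{(2)}$ on $(0,\infty)$ with $$\hat z(r)\sim\tfrac14\,e^{-r^2}r^{2\mu}\,(r,1,0,0)\wedge(0,0,r,1)\qquad(r\to\infty).$$ (The relations $\sim$ are understood coordinatewise, with an error that is small compared with the natural scale of the coordinate: near $0$ the second and fourth components of vectors of $\mathbb C^4$ are measured in units of $1/r$, and at $\infty$ the first and third components of row vectors are measured in units of $r$.) The Evans function is $$E_j(\lambda)=\hat z(r)\cdot\hat y(r).$$ Then for every $j\in\mathbb Z$ and $\lambda\in\mathbb C$ the number $E_j(\lambda)$ exists, does not depend on $r>0$ and is uniquely determined, and $$\overline{E_j(\lambda)}=E_j(-\bar\lambda),\qquad E_j(\lambda)=E_{-j}(-\lambda).$$ In particular, $E_j(\lambda)$ is real for $\lambda$ purely imaginary, and $E_0(\lambda)=E_0(-\lambda)=\overline{E_0(\bar\lambda)}$. -/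

import Mathlib

open Filter Topology ComplexConjugate

noncomputable section

/-- A vortex profile of degree `m` and frequency `μ`: a non-negative solution `w` on `(0, ∞)` of
`-w'' - w' / r + m² w / r² + r² w + 2 |w|² w - 2 μ w = 0` which is bounded as `r → 0⁺` and tends
to `0` as `r → ∞`.  Only the values of `w` on `(0, ∞)` matter. -/
structure IsVortexProfile (m : ℕ) (μ : ℝ) (w : ℝ → ℝ) : Prop where
  nonneg : ∀ r : ℝ, 0 < r → 0 ≤ w r
  ode : ∃ w₁ w₂ : ℝ → ℝ, ∀ r : ℝ, 0 < r →
    HasDerivAt w (w₁ r) r ∧ HasDerivAt w₁ (w₂ r) r ∧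
      -w₂ r - w₁ r / r + (m : ℝ) ^ 2 / r ^ 2 * w r + r ^ 2 * w r
        + 2 * |w r| ^ 2 * w r - 2 * μ * w r = 0
  bounded_zero : ∃ C : ℝ, ∀ᶠ r in 𝓝[>] (0 : ℝ), |w r| ≤ C
  tendsto_infty : Tendsto w atTop (𝓝 0)

/-- The coefficient `k⁺(r, λ) = (j + m)² / r² + r² - 2 μ - 2 i λ`. -/
def kPlus (m : ℕ) (μ : ℝ) (j : ℤ) (lam : ℂ) (r : ℝ) : ℂ :=
  ((j : ℂ) + m) ^ 2 / (r : ℂ) ^ 2 + (r : ℂ) ^ 2 - 2 * μ - 2 * Complex.I * lam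

/-- The coefficient `k⁻(r, λ) = (j - m)² / r² + r² - 2 μ + 2 i λ`. -/
def kMinus (m : ℕ) (μ : ℝ) (j : ℤ) (lam : ℂ) (r : ℝ) : ℂ :=
  ((j : ℂ) - m) ^ 2 / (r : ℂ) ^ 2 + (r : ℂ) ^ 2 - 2 * μ + 2 * Complex.I * lam

/-- The part of the coefficient matrix that does not involve the profile. -/
def BInfty (m : ℕ) (μ : ℝ) (j : ℤ) (lam : ℂ) (r : ℝ) : Matrix (Fin 4) (Fin 4) ℂ :=
  !![0, 1, 0, 0;
     kPlus m μ j lam r, -1 / (r : ℂ), 0, 0;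
     0, 0, 0, 1;
     0, 0, kMinus m μ j lam r, -1 / (r : ℂ)]

/-- The part of the coefficient matrix that involves the profile. -/
def BProfile (w : ℝ → ℝ) (r : ℝ) : Matrix (Fin 4) (Fin 4) ℂ :=
  ((|w r| ^ 2 : ℝ) : ℂ) •
    !![0, 0, 0, 0;
       4, 0, 2, 0;
       0, 0, 0, 0;
       2, 0, 4, 0]

/-- The matrix `B(r, j, λ)` of the first order system `y' = B y` for
`y = (y₊, y₊', y₋, y₋')`. -/
def B (m : ℕ) (μ : ℝ) (w : ℝ → ℝ) (j : ℤ) (lam : ℂ) (r : ℝ) : Matrix (Fin 4) (Fin 4) ℂ :=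
  BInfty m μ j lam r + BProfile w r

/-- The index set `{(i, k) : i < k}` of the standard basis `eᵢ ∧ eₖ` of `Λ² ℂ⁴ = ℂ⁶`. -/
abbrev Pair : Type := {p : Fin 4 × Fin 4 // p.1 < p.2}

/-- The exterior product `u ∧ v` of two vectors of `ℂ⁴` in the coordinates of `Λ² ℂ⁴`. -/
def wedge (u v : Fin 4 → ℂ) : Pair → ℂ :=
  fun p => u p.1.1 * v p.1.2 - u p.1.2 * v p.1.1

/-- The `6 × 6` matrix of the map `u ∧ v ↦ A u ∧ v + u ∧ A v` that `A` induces on `Λ² ℂ⁴`.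
If `u' = A u` and `v' = A v`, then `(u ∧ v)' = (exteriorMatrix A) (u ∧ v)`. -/
def exteriorMatrix (A : Matrix (Fin 4) (Fin 4) ℂ) : Matrix Pair Pair ℂ :=
  Matrix.of fun p q =>
    wedge (A.mulVec (Pi.single q.1.1 1)) (Pi.single q.1.2 1) p
      + wedge (Pi.single q.1.1 1) (A.mulVec (Pi.single q.1.2 1)) p

/-- `U = y₁⁽⁰⁾ ∧ y₂⁽⁰⁾`: the solution on `(0, ∞)` of the exterior system `U' = B⁽²⁾ U` with
`U(r) ~ r^(a + b) (1, a / r, 0, 0) ∧ (0, 0, 1, b / r)` as `r → 0⁺`, where `a = |j + m|` and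
`b = |j - m|`.  Second and fourth components (the derivatives) are measured in units of `1 / r`,
so the asymptotic relation reads: `U(r)`, with the coordinate of `eᵢ ∧ eₖ` multiplied by
`sᵢ sₖ` for `s = (1, r, 1, r)` and divided by `r^(a + b)`, tends to
`(1, a, 0, 0) ∧ (0, 0, 1, b)`. -/
structure IsSolutionAtZero (m : ℕ) (μ : ℝ) (w : ℝ → ℝ) (j : ℤ) (lam : ℂ)
    (U : ℝ → Pair → ℂ) : Prop where
  ode : ∀ r : ℝ, 0 < r →
    HasDerivAt U ((exteriorMatrix (B m μ w j lam r)).mulVec (U r)) r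
  asymptotics : ∀ p : Pair,
    Tendsto
      (fun r : ℝ =>
        ((![1, r, 1, r] p.1.1 * ![1, r, 1, r] p.1.2
          / r ^ ((j + m).natAbs + (j - m).natAbs) : ℝ) : ℂ) * U r p)
      (𝓝[>] 0)
      (𝓝 (wedge ![1, ((j + m).natAbs : ℂ), 0, 0] ![0, 0, 1, ((j - m).natAbs : ℂ)] p))

/-- `V = z₁⁽∞⁾ ∧ z₂⁽∞⁾`: the solution on `(0, ∞)` of the adjoint exterior system
`V' = -V B⁽²⁾` (row vectors) with
`V(r) ~ (1/4) e^(-r²) r^(2μ) (r, 1, 0, 0) ∧ (0, 0, r, 1)` as `r → ∞`.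
Here `z₁ ~ (1/2) e^(-r²/2) r^(μ + iλ) (r, 1, 0, 0)` and
`z₂ ~ (1/2) e^(-r²/2) r^(μ - iλ) (0, 0, r, 1)` are the first two rows of the inverse of the matrix
whose columns are
`y₁ ~ e^(r²/2) r^(-(μ + iλ)) (1/r, 1, 0, 0)`, `y₂ ~ e^(r²/2) r^(-(μ - iλ)) (0, 0, 1/r, 1)`,
`y₃ ~ e^(-r²/2) r^(μ + iλ) (1/r, -1, 0, 0)`, `y₄ ~ e^(-r²/2) r^(μ - iλ) (0, 0, 1/r, -1)`.
First and third components are measured in units of `r`. -/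
structure IsAdjointSolutionAtInfinity (m : ℕ) (μ : ℝ) (w : ℝ → ℝ) (j : ℤ) (lam : ℂ)
    (V : ℝ → Pair → ℂ) : Prop where
  ode : ∀ r : ℝ, 0 < r →
    HasDerivAt V (-(Matrix.vecMul (V r) (exteriorMatrix (B m μ w j lam r)))) r
  asymptotics : ∀ p : Pair,
    Tendsto
      (fun r : ℝ =>
        ((![r⁻¹, 1, r⁻¹, 1] p.1.1 * ![r⁻¹, 1, r⁻¹, 1] p.1.2
          / (Real.exp (-r ^ 2) * r ^ (2 * μ)) : ℝ) : ℂ) * V r p)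
      atTop
      (𝓝 ((1 / 4 : ℂ) * wedge ![1, 1, 0, 0] ![0, 0, 1, 1] p))

/-- `e` is a value of the Evans function at `(j, λ)`: the pairing `V(r) · U(r)` of a solution at
infinity of the adjoint exterior system with a solution at zero of the exterior system is equal
to `e` for every `r > 0`. -/
def IsEvansValue (m : ℕ) (μ : ℝ) (w : ℝ → ℝ) (j : ℤ) (lam e : ℂ) : Prop :=
  ∃ U V : ℝ → Pair → ℂ,
    IsSolutionAtZero m μ w j lam U ∧ IsAdjointSolutionAtInfinity m μ w j lam V ∧
      ∀ r : ℝ, 0 < r → dotProduct (V r) (U r) = e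

open Classical in
/-- The Evans function `E_j(λ)`.  The default value `0` is not used: that a value exists and is
unique is part of the theorem. -/
def evansFunction (m : ℕ) (μ : ℝ) (w : ℝ → ℝ) (j : ℤ) (lam : ℂ) : ℂ :=
  if h : ∃ e : ℂ, IsEvansValue m μ w j lam e then h.choose else 0

end

/-! Both symmetries of `E_j` come from symmetries of the problems that define `ŷ` and `ẑ`. Apart
from `λ` all coefficients are real, and complex conjugation exchanges `λ` and `-conj λ`. Exchanging
the `+` and `-` components exchanges `k⁺` and `k⁻` after `(j, λ) ↦ (-j, -λ)`. Each operation carries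
a pair of normalized solutions to such a pair and conjugates, respectively preserves, the pairing
(`IsEvansValue.conj`, `IsEvansValue.swap`). What remains is that a value exists and is unique.

The pairing of a solution with an adjoint solution is constant (`pairing_eq`), so it is enough to
construct `ŷ` and `ẑ` and to see that each is determined near its singular end. Both ends are
brought to one form. With `x = -log r`, respectively `x = log r`, and with the prescribed leading
factor divided out, adapted coordinates satisfy `Zᵢ' = dᵢ Zᵢ + (R Z)ᵢ` as `x → ∞`. Here `d₀ = 0`
belongs to the normalized solution, the other `dᵢ` are positive, and `R` is exponentially small up
to a small multiple of `dᵢ` (`IsBackwardStable`). The sought solution is thus the least growing one.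
Integrating from `x = ∞` is stable, and it yields existence on the whole line as the fixed point of
a contraction in a weighted sup norm (`IsBackwardStable.exists_solution`). The same estimate forces
a bounded solution with no leading part to vanish for large `x`
(`IsBackwardStable.eventually_eq_zero`).

Two inputs remain. At infinity the zero-rate coordinate tolerates only an integrable perturbation,
which requires `w² = O(r⁻²)` (`IsVortexProfile.decay`). For uniqueness, the asymptotic relations
control the adapted coordinates only up to powers of `r`, and the differential equations improve
this to boundedness (`exists_eq_zero_near_zero`, `exists_eq_zero_near_infinity`). -/

noncomputable section

/-! ### The exterior system and its adjoint in coordinates; constancy of the pairing. -/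

/-- The element `(i, k)` of the index set of `Λ² ℂ⁴`. -/
abbrev pair (i k : Fin 4) (h : i < k := by decide) : Pair := ⟨(i, k), h⟩

theorem forall_pair {P : Pair → Prop} :
    (∀ p, P p) ↔ P (pair 0 1) ∧ P (pair 0 2) ∧ P (pair 0 3) ∧ P (pair 1 2) ∧ P (pair 1 3) ∧
      P (pair 2 3) := by
  refine ⟨fun h => ⟨h _, h _, h _, h _, h _, h _⟩, ?_⟩
  rintro ⟨h1, h2, h3, h4, h5, h6⟩ ⟨⟨i, k⟩, h⟩
  fin_cases i <;> fin_cases k <;> first | assumption | exact absurd h (by decide)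

theorem sum_pair {M : Type*} [AddCommMonoid M] (f : Pair → M) :
    ∑ p, f p = f (pair 0 1) + f (pair 0 2) + f (pair 0 3) + f (pair 1 2) + f (pair 1 3) +
      f (pair 2 3) := by
  have h : (Finset.univ : Finset Pair) =
      {pair 0 1, pair 0 2, pair 0 3, pair 1 2, pair 1 3, pair 2 3} := by decide
  rw [h]
  repeat rw [Finset.sum_insert (by decide)]
  rw [Finset.sum_singleton]
  simp only [add_assoc]

/-- The diagonal coefficient of `y₊` in the equation for `y₊''`. -/
def coefPlus (m : ℕ) (μ : ℝ) (w : ℝ → ℝ) (j : ℤ) (lam : ℂ) (r : ℝ) : ℂ :=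
  kPlus m μ j lam r + 4 * (w r : ℂ) ^ 2

/-- The diagonal coefficient of `y₋` in the equation for `y₋''`. -/
def coefMinus (m : ℕ) (μ : ℝ) (w : ℝ → ℝ) (j : ℤ) (lam : ℂ) (r : ℝ) : ℂ :=
  kMinus m μ j lam r + 4 * (w r : ℂ) ^ 2

section Coordinates

variable (m : ℕ) (μ : ℝ) (w : ℝ → ℝ) (j : ℤ) (lam : ℂ)

theorem exteriorMatrix_mulVec (r : ℝ) (U : Pair → ℂ) :
    (exteriorMatrix (B m μ w j lam r)).mulVec U (pair 0 1)
        = 2 * (w r : ℂ) ^ 2 * U (pair 0 2) - U (pair 0 1) / r ∧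
    (exteriorMatrix (B m μ w j lam r)).mulVec U (pair 0 2) = U (pair 1 2) + U (pair 0 3) ∧
    (exteriorMatrix (B m μ w j lam r)).mulVec U (pair 0 3)
        = U (pair 1 3) + coefMinus m μ w j lam r * U (pair 0 2) - U (pair 0 3) / r ∧
    (exteriorMatrix (B m μ w j lam r)).mulVec U (pair 1 2)
        = coefPlus m μ w j lam r * U (pair 0 2) - U (pair 1 2) / r + U (pair 1 3) ∧
    (exteriorMatrix (B m μ w j lam r)).mulVec U (pair 1 3)
        = coefPlus m μ w j lam r * U (pair 0 3) + 2 * (w r : ℂ) ^ 2 * U (pair 2 3)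
          + coefMinus m μ w j lam r * U (pair 1 2) - 2 * (w r : ℂ) ^ 2 * U (pair 0 1)
          - 2 * U (pair 1 3) / r ∧
    (exteriorMatrix (B m μ w j lam r)).mulVec U (pair 2 3)
        = -(U (pair 2 3) / r) - 2 * (w r : ℂ) ^ 2 * U (pair 0 2) := by
  refine ⟨?_, ?_, ?_, ?_, ?_, ?_⟩ <;>
  · simp only [Matrix.mulVec, dotProduct, sum_pair, exteriorMatrix, Matrix.of_apply, wedge,
      Fin.sum_univ_four, B, BInfty, BProfile, Matrix.add_apply, Matrix.smul_apply,
      coefPlus, coefMinus]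
    simp
    try ring

theorem vecMul_exteriorMatrix (r : ℝ) (V : Pair → ℂ) :
    Matrix.vecMul V (exteriorMatrix (B m μ w j lam r)) (pair 0 1)
        = -(V (pair 0 1) / r) - 2 * (w r : ℂ) ^ 2 * V (pair 1 3) ∧
    Matrix.vecMul V (exteriorMatrix (B m μ w j lam r)) (pair 0 2)
        = 2 * (w r : ℂ) ^ 2 * V (pair 0 1) + coefMinus m μ w j lam r * V (pair 0 3)
          + coefPlus m μ w j lam r * V (pair 1 2) - 2 * (w r : ℂ) ^ 2 * V (pair 2 3) ∧
    Matrix.vecMul V (exteriorMatrix (B m μ w j lam r)) (pair 0 3)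
        = V (pair 0 2) - V (pair 0 3) / r + coefPlus m μ w j lam r * V (pair 1 3) ∧
    Matrix.vecMul V (exteriorMatrix (B m μ w j lam r)) (pair 1 2)
        = V (pair 0 2) - V (pair 1 2) / r + coefMinus m μ w j lam r * V (pair 1 3) ∧
    Matrix.vecMul V (exteriorMatrix (B m μ w j lam r)) (pair 1 3)
        = V (pair 0 3) + V (pair 1 2) - 2 * V (pair 1 3) / r ∧
    Matrix.vecMul V (exteriorMatrix (B m μ w j lam r)) (pair 2 3)
        = 2 * (w r : ℂ) ^ 2 * V (pair 1 3) - V (pair 2 3) / r := by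
  refine ⟨?_, ?_, ?_, ?_, ?_, ?_⟩ <;>
  · simp only [Matrix.vecMul, dotProduct, sum_pair, exteriorMatrix, Matrix.of_apply, wedge,
      Fin.sum_univ_four, B, BInfty, BProfile, Matrix.add_apply, Matrix.smul_apply,
      coefPlus, coefMinus, Matrix.mulVec]
    simp
    try ring

theorem hasDerivAt_exterior_iff {U : ℝ → Pair → ℂ} {r : ℝ} :
    HasDerivAt U ((exteriorMatrix (B m μ w j lam r)).mulVec (U r)) r ↔
      HasDerivAt (fun s => U s (pair 0 1))
        (2 * (w r : ℂ) ^ 2 * U r (pair 0 2) - U r (pair 0 1) / r) r ∧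
      HasDerivAt (fun s => U s (pair 0 2)) (U r (pair 1 2) + U r (pair 0 3)) r ∧
      HasDerivAt (fun s => U s (pair 0 3))
        (U r (pair 1 3) + coefMinus m μ w j lam r * U r (pair 0 2) - U r (pair 0 3) / r) r ∧
      HasDerivAt (fun s => U s (pair 1 2))
        (coefPlus m μ w j lam r * U r (pair 0 2) - U r (pair 1 2) / r + U r (pair 1 3)) r ∧
      HasDerivAt (fun s => U s (pair 1 3))
        (coefPlus m μ w j lam r * U r (pair 0 3) + 2 * (w r : ℂ) ^ 2 * U r (pair 2 3)
          + coefMinus m μ w j lam r * U r (pair 1 2) - 2 * (w r : ℂ) ^ 2 * U r (pair 0 1)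
          - 2 * U r (pair 1 3) / r) r ∧
      HasDerivAt (fun s => U s (pair 2 3))
        (-(U r (pair 2 3) / r) - 2 * (w r : ℂ) ^ 2 * U r (pair 0 2)) r := by
  obtain ⟨h1, h2, h3, h4, h5, h6⟩ := exteriorMatrix_mulVec m μ w j lam r (U r)
  rw [hasDerivAt_pi, forall_pair, h1, h2, h3, h4, h5, h6]

theorem hasDerivAt_adjoint_iff {V : ℝ → Pair → ℂ} {r : ℝ} :
    HasDerivAt V (-(Matrix.vecMul (V r) (exteriorMatrix (B m μ w j lam r)))) r ↔
      HasDerivAt (fun s => V s (pair 0 1))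
        (-(-(V r (pair 0 1) / r) - 2 * (w r : ℂ) ^ 2 * V r (pair 1 3))) r ∧
      HasDerivAt (fun s => V s (pair 0 2))
        (-(2 * (w r : ℂ) ^ 2 * V r (pair 0 1) + coefMinus m μ w j lam r * V r (pair 0 3)
          + coefPlus m μ w j lam r * V r (pair 1 2) - 2 * (w r : ℂ) ^ 2 * V r (pair 2 3))) r ∧
      HasDerivAt (fun s => V s (pair 0 3))
        (-(V r (pair 0 2) - V r (pair 0 3) / r + coefPlus m μ w j lam r * V r (pair 1 3))) r ∧
      HasDerivAt (fun s => V s (pair 1 2))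
        (-(V r (pair 0 2) - V r (pair 1 2) / r + coefMinus m μ w j lam r * V r (pair 1 3))) r ∧
      HasDerivAt (fun s => V s (pair 1 3))
        (-(V r (pair 0 3) + V r (pair 1 2) - 2 * V r (pair 1 3) / r)) r ∧
      HasDerivAt (fun s => V s (pair 2 3))
        (-(2 * (w r : ℂ) ^ 2 * V r (pair 1 3) - V r (pair 2 3) / r)) r := by
  obtain ⟨h1, h2, h3, h4, h5, h6⟩ := vecMul_exteriorMatrix m μ w j lam r (V r)
  rw [hasDerivAt_pi, forall_pair]
  simp only [Pi.neg_apply]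
  rw [h1, h2, h3, h4, h5, h6]

/-- The derivative of the pairing is `-(V B⁽²⁾) · U + V · (B⁽²⁾ U) = 0`, and the half-line is
convex. -/
theorem pairing_eq {U V : ℝ → Pair → ℂ}
    (hU : ∀ r : ℝ, 0 < r → HasDerivAt U ((exteriorMatrix (B m μ w j lam r)).mulVec (U r)) r)
    (hV : ∀ r : ℝ, 0 < r →
      HasDerivAt V (-(Matrix.vecMul (V r) (exteriorMatrix (B m μ w j lam r)))) r)
    {r s : ℝ} (hr : 0 < r) (hs : 0 < s) : dotProduct (V r) (U r) = dotProduct (V s) (U s) := by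
  have key : ∀ t ∈ Set.Ioi (0 : ℝ), HasDerivAt (fun t => dotProduct (V t) (U t)) 0 t := by
    intro t ht
    have h1 := hasDerivAt_pi.1 (hU t ht)
    have h2 := hasDerivAt_pi.1 (hV t ht)
    have h3 := HasDerivAt.fun_sum (u := Finset.univ) fun p _ => (h2 p).fun_mul (h1 p)
    refine h3.congr_deriv ?_
    rw [Finset.sum_add_distrib]
    have : dotProduct (Matrix.vecMul (V t) (exteriorMatrix (B m μ w j lam t))) (U t)
      = dotProduct (V t) ((exteriorMatrix (B m μ w j lam t)).mulVec (U t)) := by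
      rw [Matrix.dotProduct_mulVec]
    simp only [dotProduct] at this
    simp only [Pi.neg_apply, neg_mul, Finset.sum_neg_distrib, this]
    ring
  refine (convex_Ioi (0 : ℝ)).is_const_of_fderivWithin_eq_zero (𝕜 := ℝ)
    (f := fun t => dotProduct (V t) (U t))
    (fun t ht => (key t ht).differentiableAt.differentiableWithinAt) ?_ hr hs
  intro t ht
  rw [fderivWithin_of_isOpen isOpen_Ioi ht]
  ext
  simpa using (key t ht).deriv

end Coordinates

/-! ### Scalar estimates for integration from infinity. -/

open MeasureTheory Set in
-- A decreasing non-negative `b` has an integrable derivative with tail integrals at most `b x`, so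
-- domination of `g` by `-b' K` gives everything.
theorem tail_integral {g : ℝ → ℂ} {b b' : ℝ → ℝ} {K : ℝ} (hg : Continuous g) (hK : 0 ≤ K)
    (hb : ∀ x, HasDerivAt b (b' x) x) (hb0 : ∀ x, 0 ≤ b x) (hb' : ∀ x, b' x ≤ 0)
    (hgb : ∀ x, ‖g x‖ ≤ -b' x * K) (x : ℝ) :
    IntegrableOn g (Ioi x) ∧ ‖∫ s in Ioi x, g s‖ ≤ K * b x ∧
      HasDerivAt (fun y => ∫ s in Ioi y, g s) (-g x) x := by
  have hanti : Antitone b := antitone_of_hasDerivAt_nonpos hb hb'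
  have hlim : Tendsto b atTop (𝓝 (⨅ i, b i)) :=
    tendsto_atTop_ciInf hanti ⟨0, by rintro _ ⟨y, rfl⟩; exact hb0 y⟩
  have hint' : ∀ y, IntegrableOn b' (Ioi y) := fun y =>
    integrableOn_Ioi_deriv_of_nonpos' (fun s _ => hb s) (fun s _ => hb' s) hlim
  have hint : ∀ y, IntegrableOn g (Ioi y) := fun y => by
    refine Integrable.mono' ((hint' y).neg.mul_const K) hg.aestronglyMeasurable ?_
    exact ae_of_all _ fun s => by simpa using hgb s
  refine ⟨hint x, ?_, ?_⟩
  · calc ‖∫ s in Ioi x, g s‖ ≤ ∫ s in Ioi x, -b' s * K :=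
          norm_integral_le_of_norm_le ((hint' x).neg.mul_const K) (ae_of_all _ hgb)
      _ = (b x - ⨅ i, b i) * K := by
          rw [integral_mul_const, integral_neg,
            integral_Ioi_of_hasDerivAt_of_nonpos' (fun s _ => hb s) (fun s _ => hb' s) hlim]
          ring
      _ ≤ K * b x := by
          have : 0 ≤ ⨅ i, b i := Real.iInf_nonneg hb0
          nlinarith
  · have h1 : (fun y => ∫ s in Ioi y, g s) = fun y => (∫ s in Ioi x, g s) - ∫ s in x..y, g s := by
      funext y
      rw [← intervalIntegral.integral_Ioi_sub_Ioi' (hint x) (hint y)]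
      ring
    rw [h1]
    exact (intervalIntegral.integral_hasDerivAt_right (hg.intervalIntegrable _ _)
      (hg.stronglyMeasurableAtFilter _ _) hg.continuousAt).const_sub _

/-- The factor `exp (-D)` removes the diagonal term, so `exp (-D) f` has derivative `exp (-D) g` and
limit `0`. The barrier `M exp (-D) (C exp (-x) + 1 / 4)` decreases at least as fast as this function
can vary. Comparison on `[x, y]` followed by `y → ∞` gives the bound. -/
theorem norm_le_of_backward {f g : ℝ → ℂ} {D d : ℝ → ℝ} {M C x₀ : ℝ} (hM : 0 ≤ M) (hC : 0 ≤ C)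
    (hD : ∀ x, HasDerivAt D (d x) x) (hd : ∀ x, 0 ≤ d x)
    (hf : ∀ x, x₀ ≤ x → HasDerivAt f (d x * f x + g x) x)
    (hg : ∀ x, x₀ ≤ x → ‖g x‖ ≤ M * (C * Real.exp (-x) + d x / 4))
    (hlim : Tendsto (fun x => (Real.exp (-D x) : ℂ) * f x) atTop (𝓝 0)) (x : ℝ) (hx : x₀ ≤ x) :
    ‖f x‖ ≤ M * (C * Real.exp (-x) + 1 / 4) := by
  set h : ℝ → ℂ := fun x => ((Real.exp (-D x) : ℝ) : ℂ) * f x with hh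
  have hE : ∀ y, HasDerivAt (fun y => Real.exp (-D y)) (Real.exp (-D y) * -d y) y :=
    fun y => (hD y).neg.exp
  have hder : ∀ y, x₀ ≤ y → HasDerivAt h (Real.exp (-D y) * g y) y := by
    intro y hy
    refine ((hE y).ofReal_comp.mul (hf y hy)).congr_deriv ?_
    push_cast
    ring
  have hB : ∀ y, HasDerivAt (fun y => M * (Real.exp (-D x) * (C * Real.exp (-x) + 1 / 4))
      - M * (Real.exp (-D y) * (C * Real.exp (-y) + 1 / 4)))
      (M * Real.exp (-D y) * (d y * (C * Real.exp (-y) + 1 / 4) + C * Real.exp (-y))) y := by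
    intro y
    have h2 : HasDerivAt (fun y => C * Real.exp (-y) + 1 / 4) (C * (Real.exp (-y) * -1)) y :=
      (((hasDerivAt_neg y).exp).const_mul C).add_const _
    refine ((((hE y).mul h2).const_mul M).const_sub _).congr_deriv ?_
    ring
  have key : ∀ y, x ≤ y → ‖h y - h x‖ ≤ M * (Real.exp (-D x) * (C * Real.exp (-x) + 1 / 4)) := by
    intro y hy
    have := image_norm_le_of_norm_deriv_right_le_deriv_boundary (a := x) (b := y)
      (f := fun s => h s - h x) (f' := fun s => Real.exp (-D s) * g s)
      (fun s hs => ((hder s (hx.trans hs.1)).sub_const _).continuousAt.continuousWithinAt)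
      (fun s hs => ((hder s (hx.trans hs.1)).sub_const _).hasDerivWithinAt)
      (by simp) hB ?_ (Set.right_mem_Icc.2 hy)
    · refine this.trans (sub_le_self _ ?_)
      positivity
    · intro s hs
      rw [norm_mul, Complex.norm_real, Real.norm_of_nonneg (Real.exp_nonneg _)]
      have h3 := hg s (hx.trans hs.1)
      have h4 := hd s
      calc Real.exp (-D s) * ‖g s‖
          ≤ Real.exp (-D s) * (M * (C * Real.exp (-s) + d s / 4)) := by gcongr
        _ ≤ Real.exp (-D s) * (M * (d s * (C * Real.exp (-s) + 1 / 4) + C * Real.exp (-s))) := by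
          have : 0 ≤ d s * (C * Real.exp (-s)) := by positivity
          refine mul_le_mul_of_nonneg_left (mul_le_mul_of_nonneg_left ?_ hM) (Real.exp_nonneg _)
          linarith
        _ = _ := by ring
  have h5 : ‖h x‖ ≤ M * (Real.exp (-D x) * (C * Real.exp (-x) + 1 / 4)) := by
    have : Tendsto (fun y => ‖h y - h x‖) atTop (𝓝 ‖0 - h x‖) := (hlim.sub_const _).norm
    rw [zero_sub, norm_neg] at this
    exact le_of_tendsto this (eventually_atTop.2 ⟨x, key⟩)
  rw [hh] at h5
  simp only [norm_mul, Complex.norm_real, Real.norm_of_nonneg (Real.exp_nonneg _)] at h5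
  have := Real.exp_pos (-D x)
  refine le_of_mul_le_mul_left ?_ this
  linarith

/-! ### Backward stable systems: uniqueness, and the weight for existence. -/

section System

variable {ι : Type*} [Fintype ι]

/-- The data of a linear system `Zᵢ' = dᵢ Zᵢ + ∑ₖ Rᵢₖ Zₖ` on the line with a diagonal part that is
non-negative, with antiderivatives `Dᵢ`, and an off-diagonal part that is exponentially small near
infinity, up to a small multiple of the diagonal part. -/
structure IsBackwardStable (D d : ι → ℝ → ℝ) (R : ℝ → Matrix ι ι ℂ) : Prop where
  hasDerivAt : ∀ i x, HasDerivAt (D i) (d i x) x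
  nonneg : ∀ i x, 0 ≤ d i x
  continuous_diag : ∀ i, Continuous (d i)
  continuous_rest : ∀ i k, Continuous fun x => R x i k
  bound : ∀ i k, ∃ C : ℝ, ∀ᶠ x in atTop,
    ‖R x i k‖ ≤ C * Real.exp (-x) + d i x / (4 * Fintype.card ι)

variable {D d : ι → ℝ → ℝ} {R : ℝ → Matrix ι ι ℂ}

theorem IsBackwardStable.row_bound (h : IsBackwardStable D d R) :
    ∃ C x₀ : ℝ, 0 ≤ C ∧ ∀ x, x₀ ≤ x → ∀ i, ∑ k, ‖R x i k‖ ≤ C * Real.exp (-x) + d i x / 4 := by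
  choose C hC using h.bound
  have h1 : ∀ᶠ x in atTop, ∀ i k, ‖R x i k‖ ≤ C i k * Real.exp (-x) + d i x / (4 * Fintype.card ι) :=
    eventually_all.2 fun i => eventually_all.2 fun k => hC i k
  obtain ⟨x₀, hx₀⟩ := eventually_atTop.1 h1
  refine ⟨∑ i, ∑ k, |C i k|, x₀, by positivity, fun x hx i => ?_⟩
  have hcard : (Fintype.card ι : ℝ) ≠ 0 := by
    have : Nonempty ι := ⟨i⟩
    exact_mod_cast Fintype.card_ne_zero
  calc ∑ k, ‖R x i k‖ ≤ ∑ k, (|C i k| * Real.exp (-x) + d i x / (4 * Fintype.card ι)) := by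
        refine Finset.sum_le_sum fun k _ => (hx₀ x hx i k).trans ?_
        gcongr
        exact le_abs_self _
    _ = (∑ k, |C i k|) * Real.exp (-x) + d i x / 4 := by
        rw [Finset.sum_add_distrib, Finset.sum_mul, Finset.sum_const, Finset.card_univ, nsmul_eq_mul]
        congr 1
        field_simp
    _ ≤ _ := by
        refine add_le_add_left (mul_le_mul_of_nonneg_right ?_ (Real.exp_nonneg _)) _
        exact Finset.single_le_sum (f := fun i => ∑ k, |C i k|) (fun i _ => by positivity)
          (Finset.mem_univ i)

theorem norm_mulVec_le (A : Matrix ι ι ℂ) {z : ι → ℂ} {N : ℝ} (hz : ∀ k, ‖z k‖ ≤ N) (i : ι) :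
    ‖A.mulVec z i‖ ≤ (∑ k, ‖A i k‖) * N := by
  rw [Finset.sum_mul]
  refine (norm_sum_le _ _).trans (Finset.sum_le_sum fun k _ => ?_)
  rw [norm_mul]
  gcongr
  exact hz k

theorem IsBackwardStable.eventually_eq_zero (h : IsBackwardStable D d R) {Z : ℝ → ι → ℂ} {x₁ M : ℝ}
    (hZ : ∀ x, x₁ ≤ x → ∀ i, HasDerivAt (fun s => Z s i) (d i x * Z x i + (R x).mulVec (Z x) i) x)
    (hM : ∀ x, x₁ ≤ x → ∀ i, ‖Z x i‖ ≤ M)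
    (hlim : ∀ i, Tendsto (fun x => (Real.exp (-D i x) : ℂ) * Z x i) atTop (𝓝 0)) :
    ∀ᶠ x in atTop, Z x = 0 := by
  obtain ⟨C, x₀, hC, hrow⟩ := h.row_bound
  have hsmall : ∀ᶠ x in atTop, C * Real.exp (-x) < 1 / 4 := by
    have : Tendsto (fun x => C * Real.exp (-x)) atTop (𝓝 (C * 0)) :=
      (Real.tendsto_exp_neg_atTop_nhds_zero).const_mul C
    rw [mul_zero] at this
    exact this.eventually_lt_const (by norm_num)
  obtain ⟨x₂, hx₂⟩ := eventually_atTop.1 hsmall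
  set X := max x₀ (max x₁ x₂)
  -- Beyond `X` the factor `C exp (-x) + 1 / 4` is below `1 / 2`, so every bound can be halved on
  -- the same half-line; iteration leaves only `0`.
  have step : ∀ N : ℝ, 0 ≤ N → (∀ x, X ≤ x → ∀ i, ‖Z x i‖ ≤ N) →
      ∀ x, X ≤ x → ∀ i, ‖Z x i‖ ≤ N / 2 := by
    intro N hN hNb x hx i
    have hX0 : x₀ ≤ X := le_max_left _ _
    have hX1 : x₁ ≤ X := (le_max_left _ _).trans (le_max_right _ _)
    have hX2 : x₂ ≤ X := (le_max_right _ _).trans (le_max_right _ _)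
    have := norm_le_of_backward (M := N) (C := C) (x₀ := X) hN hC (h.hasDerivAt i) (h.nonneg i)
      (fun y hy => hZ y (hX1.trans hy) i) (fun y hy => ?_) (hlim i) x hx
    · have h2 := hx₂ x (hX2.trans hx)
      nlinarith
    · rw [mul_comm]
      refine (norm_mulVec_le _ (hNb y hy) i).trans ?_
      gcongr
      exact hrow y (hX0.trans hy) i
  have all : ∀ n : ℕ, ∀ x, X ≤ x → ∀ i, ‖Z x i‖ ≤ |M| / 2 ^ n := by
    intro n
    induction n with
    | zero =>
      intro x hx i
      have hX1 : x₁ ≤ X := (le_max_left _ _).trans (le_max_right _ _)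
      simpa using (hM x (hX1.trans hx) i).trans (le_abs_self M)
    | succ n ih =>
      intro x hx i
      have := step _ (by positivity) ih x hx i
      rwa [pow_succ, ← div_div]
  refine eventually_atTop.2 ⟨X, fun x hx => funext fun i => ?_⟩
  have hl : Tendsto (fun n : ℕ => |M| / 2 ^ n) atTop (𝓝 0) :=
    tendsto_const_nhds.div_atTop (tendsto_pow_atTop_atTop_of_one_lt (by norm_num))
  have := ge_of_tendsto' hl fun n => all n x hx i
  simpa using this

/-- The excess `ρ` of the row sums over `dᵢ / 4` is `O(exp (-x))`, hence integrable at `+∞`, and `ψ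
= exp (-4 ∫ ρ)` stays away from `0`. Towards `-∞` the weight may grow; this absorbs the region where
`R` is not small and makes the later contraction global on the line. -/
theorem IsBackwardStable.exists_weight (h : IsBackwardStable D d R) :
    ∃ ψ ρ : ℝ → ℝ, (∀ x, 0 ≤ ρ x) ∧ (∀ x, HasDerivAt ψ (-(4 * ρ x * ψ x)) x) ∧
      (∃ c > 0, ∀ x, c ≤ ψ x) ∧ ∀ x i, ∑ k, ‖R x i k‖ ≤ ρ x + d i x / 4 := by
  obtain ⟨C, x₀, hC, hrow⟩ := h.row_bound
  set ρ : ℝ → ℝ := fun x => ∑ i, max 0 (∑ k, ‖R x i k‖ - d i x / 4) with hρ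
  have hρ0 : ∀ x, 0 ≤ ρ x := fun x => Finset.sum_nonneg fun i _ => le_max_left _ _
  have hρc : Continuous ρ := by
    refine continuous_finsetSum _ fun i _ => continuous_const.max ?_
    exact (continuous_finsetSum _ fun k _ => (h.continuous_rest i k).norm).sub
      ((h.continuous_diag i).div_const _)
  set P : ℝ → ℝ := fun x => ∫ s in (0 : ℝ)..x, ρ s
  have hP : ∀ x, HasDerivAt P (ρ x) x := fun x =>
    intervalIntegral.integral_hasDerivAt_right (hρc.intervalIntegrable _ _)
      (hρc.stronglyMeasurableAtFilter _ _) hρc.continuousAt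
  have hmono : Monotone P := monotone_of_hasDerivAt_nonneg hP hρ0
  set K := Fintype.card ι * C
  have hρK : ∀ x, x₀ ≤ x → ρ x ≤ K * Real.exp (-x) := by
    intro x hx
    calc ρ x ≤ ∑ _i : ι, C * Real.exp (-x) := by
          refine Finset.sum_le_sum fun i _ => max_le (by positivity) ?_
          linarith [hrow x hx i]
      _ = _ := by simp [K, mul_assoc]
  have hPb : ∀ x, P x ≤ P x₀ + K * Real.exp (-x₀) := by
    intro x
    rcases le_total x x₀ with hx | hx
    · have : 0 ≤ K * Real.exp (-x₀) := by positivity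
      linarith [hmono hx]
    -- Since `ρ ≤ K exp (-y)` beyond `x₀`, the function `P + K exp (-y)` decreases there, which
    -- bounds `P` from above.
    · have hQ : ∀ y, HasDerivAt (fun y => P y + K * Real.exp (-y))
          (ρ y + K * (Real.exp (-y) * -1)) y := fun y =>
        (hP y).add (((hasDerivAt_neg y).exp).const_mul K)
      have := antitoneOn_of_deriv_nonpos (convex_Ici x₀)
        (fun y _ => (hQ y).continuousAt.continuousWithinAt)
        (fun y _ => (hQ y).differentiableAt.differentiableWithinAt)
        (fun y hy => by
          rw [interior_Ici] at hy
          rw [(hQ y).deriv]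
          linarith [hρK y (le_of_lt hy)]) (Set.self_mem_Ici) hx hx
      have h0 : 0 ≤ K * Real.exp (-x) := by positivity
      simp only at this
      linarith
  refine ⟨fun x => Real.exp (-(4 * P x)), ρ, hρ0, fun x => ?_,
    ⟨Real.exp (-(4 * (P x₀ + K * Real.exp (-x₀)))), Real.exp_pos _, fun x => ?_⟩, fun x i => ?_⟩
  · refine (((hP x).const_mul 4).fun_neg.exp).congr_deriv ?_
    ring
  · rw [Real.exp_le_exp]
    linarith [hPb x]
  · have h1 : max 0 (∑ k, ‖R x i k‖ - d i x / 4) ≤ ρ x :=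
      Finset.single_le_sum (f := fun i => max 0 (∑ k, ‖R x i k‖ - d i x / 4))
        (fun i _ => le_max_left _ _) (Finset.mem_univ i)
    linarith [le_max_right 0 (∑ k, ‖R x i k‖ - d i x / 4)]

end System

/-! ### Backward stable systems: existence by a weighted contraction. -/

section Existence

variable {ι : Type*} [Fintype ι] {D d : ι → ℝ → ℝ} {R : ℝ → Matrix ι ι ℂ}

/-- The integrand of the variation of constants formula. -/
def backwardIntegrand (D : ι → ℝ → ℝ) (R : ℝ → Matrix ι ι ℂ) (Z : ℝ → ι → ℂ) (i : ι) (s : ℝ) : ℂ :=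
  (Real.exp (-D i s) : ℂ) * (R s).mulVec (Z s) i

/-- The right-hand side of the variation of constants formula for the solution with limit `v`. -/
def backwardMap (D : ι → ℝ → ℝ) (R : ℝ → Matrix ι ι ℂ) (v : ι → ℂ) (Z : ℝ → ι → ℂ) (x : ℝ) (i : ι) :
    ℂ :=
  v i - (Real.exp (D i x) : ℂ) * ∫ s in Set.Ioi x, backwardIntegrand D R Z i s

theorem IsBackwardStable.backward_integral (h : IsBackwardStable D d R) {ψ ρ : ℝ → ℝ}
    (hρ : ∀ x, 0 ≤ ρ x) (hψ : ∀ x, HasDerivAt ψ (-(4 * ρ x * ψ x)) x) (hψ0 : ∀ x, 0 < ψ x)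
    (hrow : ∀ x i, ∑ k, ‖R x i k‖ ≤ ρ x + d i x / 4) {Z : ℝ → ι → ℂ} (hZ : Continuous Z) {N : ℝ}
    (hN : 0 ≤ N) (hZN : ∀ x i, ‖Z x i‖ ≤ ψ x * N) (i : ι) (x : ℝ) :
    MeasureTheory.IntegrableOn (backwardIntegrand D R Z i) (Set.Ioi x) ∧
    ‖(Real.exp (D i x) : ℂ) * ∫ s in Set.Ioi x, backwardIntegrand D R Z i s‖ ≤ ψ x * (N / 4) ∧
    HasDerivAt (fun y => ∫ s in Set.Ioi y, backwardIntegrand D R Z i s)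
      (-backwardIntegrand D R Z i x) x := by
  have hDc : Continuous (D i) :=
    continuous_iff_continuousAt.2 fun x => (h.hasDerivAt i x).continuousAt
  have hg : Continuous (backwardIntegrand D R Z i) := by
    have h1 : Continuous fun s => (R s).mulVec (Z s) i :=
      continuous_finsetSum _ fun k _ => (h.continuous_rest i k).mul ((continuous_apply k).comp hZ)
    exact (Complex.continuous_ofReal.comp (Real.continuous_exp.comp hDc.neg)).mul h1
  -- The weight is chosen so that the logarithmic derivative is `-(d + 4 ρ)`, four times the row
  -- bound `ρ + d / 4`. This is the source of the factor `1 / 4`.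
  have hb : ∀ x, HasDerivAt (fun x => Real.exp (-D i x) * ψ x)
      (-((d i x + 4 * ρ x) * (Real.exp (-D i x) * ψ x))) x := fun x => by
    refine ((h.hasDerivAt i x).fun_neg.exp.mul (hψ x)).congr_deriv ?_
    ring
  have hb0 : ∀ x, 0 ≤ Real.exp (-D i x) * ψ x := fun x =>
    mul_nonneg (Real.exp_nonneg _) (hψ0 x).le
  obtain ⟨h1, h2, h3⟩ := tail_integral (K := N / 4) hg (by positivity) hb hb0
    (fun x => neg_nonpos.2 (mul_nonneg (by linarith [h.nonneg i x, hρ x]) (hb0 x)))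
    (fun s => by
      rw [backwardIntegrand, norm_mul, Complex.norm_real, Real.norm_of_nonneg (Real.exp_nonneg _)]
      have h4 := (norm_mulVec_le (R s) (hZN s) i).trans
        (mul_le_mul_of_nonneg_right (hrow s i) (mul_nonneg (hψ0 s).le hN))
      refine (mul_le_mul_of_nonneg_left h4 (Real.exp_nonneg _)).trans (le_of_eq ?_)
      ring) x
  refine ⟨h1, ?_, h3⟩
  rw [norm_mul, Complex.norm_real, Real.norm_of_nonneg (Real.exp_nonneg _)]
  refine (mul_le_mul_of_nonneg_left h2 (Real.exp_nonneg _)).trans (le_of_eq ?_)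
  rw [Real.exp_neg]
  field_simp

theorem backwardMap_sub (v : ι → ℂ) {Z Z' : ℝ → ι → ℂ} {x : ℝ} {i : ι}
    (h : MeasureTheory.IntegrableOn (backwardIntegrand D R Z i) (Set.Ioi x))
    (h' : MeasureTheory.IntegrableOn (backwardIntegrand D R Z' i) (Set.Ioi x)) :
    backwardMap D R v Z x i - backwardMap D R v Z' x i =
      -((Real.exp (D i x) : ℂ) * ∫ s in Set.Ioi x, backwardIntegrand D R (Z - Z') i s) := by
  have : backwardIntegrand D R (Z - Z') i =
      fun s => backwardIntegrand D R Z i s - backwardIntegrand D R Z' i s := by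
    funext s
    simp only [backwardIntegrand, Pi.sub_apply, Matrix.mulVec_sub]
    ring
  rw [this, MeasureTheory.integral_sub h h', backwardMap, backwardMap]
  ring

/-- Writing `Z = ψ X` with `X` bounded and continuous, `backward_integral` says that the integral
part has norm at most `1 / 4`. The constant `v` becomes `v / ψ`, which is bounded because `ψ ≥ c`.
Banach's fixed point theorem applies. -/
theorem IsBackwardStable.exists_fixed (h : IsBackwardStable D d R) (v : ι → ℂ) {ψ ρ : ℝ → ℝ}
    (hρ : ∀ x, 0 ≤ ρ x) (hψ : ∀ x, HasDerivAt ψ (-(4 * ρ x * ψ x)) x) {c : ℝ} (hc : 0 < c)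
    (hψc : ∀ x, c ≤ ψ x) (hrow : ∀ x i, ∑ k, ‖R x i k‖ ≤ ρ x + d i x / 4) :
    ∃ (Z : ℝ → ι → ℂ) (N : ℝ), Continuous Z ∧ 0 ≤ N ∧ (∀ x i, ‖Z x i‖ ≤ ψ x * N) ∧
      Z = backwardMap D R v Z := by
  have hψ0 : ∀ x, 0 < ψ x := fun x => hc.trans_le (hψc x)
  have hψcont : Continuous ψ := continuous_iff_continuousAt.2 fun x => (hψ x).continuousAt
  have hDc : ∀ i, Continuous (D i) := fun i =>
    continuous_iff_continuousAt.2 fun x => (h.hasDerivAt i x).continuousAt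
  let lift : (BoundedContinuousFunction ℝ (ι → ℂ)) → ℝ → ι → ℂ := fun X x => (ψ x : ℂ) • X x
  have hlc : ∀ X, Continuous (lift X) := fun X =>
    (Complex.continuous_ofReal.comp hψcont).smul X.continuous
  have hln : ∀ X : BoundedContinuousFunction ℝ (ι → ℂ), ∀ x i, ‖lift X x i‖ ≤ ψ x * ‖X‖ := by
    intro X x i
    simp only [lift, Pi.smul_apply, smul_eq_mul, norm_mul, Complex.norm_real,
      Real.norm_of_nonneg (hψ0 x).le]
    exact mul_le_mul_of_nonneg_left ((norm_le_pi_norm _ i).trans (X.norm_coe_le_norm x)) (hψ0 x).le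
  have hI := fun (X : BoundedContinuousFunction ℝ (ι → ℂ)) =>
    h.backward_integral hρ hψ hψ0 hrow (hlc X) (norm_nonneg X) (hln X)
  have hcont : ∀ X, Continuous (backwardMap D R v (lift X)) := by
    intro X
    refine continuous_pi fun i => continuous_const.sub (Continuous.mul ?_ ?_)
    · exact Complex.continuous_ofReal.comp (Real.continuous_exp.comp (hDc i))
    · exact continuous_iff_continuousAt.2 fun x => (hI X i x).2.2.continuousAt
  let T : BoundedContinuousFunction ℝ (ι → ℂ) → BoundedContinuousFunction ℝ (ι → ℂ) := fun X =>
    BoundedContinuousFunction.ofNormedAddCommGroup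
      (fun x => ((ψ x)⁻¹ : ℂ) • backwardMap D R v (lift X) x)
      (((Complex.continuous_ofReal.comp hψcont).inv₀
        (fun x => Complex.ofReal_ne_zero.2 (hψ0 x).ne')).smul (hcont X))
      (c⁻¹ * ‖v‖ + ‖X‖ / 4) (by
        intro x
        refine (pi_norm_le_iff_of_nonneg (by positivity)).2 fun i => ?_
        have hinv : (ψ x)⁻¹ ≤ c⁻¹ := inv_anti₀ hc (hψc x)
        have h1 := (hI X i x).2.1
        have h2 : ‖backwardMap D R v (lift X) x i‖ ≤ ‖v‖ + ψ x * (‖X‖ / 4) :=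
          (norm_sub_le _ _).trans (add_le_add (norm_le_pi_norm v i) h1)
        have h3 : 0 < (ψ x)⁻¹ := inv_pos.2 (hψ0 x)
        rw [Pi.smul_apply, smul_eq_mul, norm_mul, norm_inv, Complex.norm_real,
          Real.norm_of_nonneg (hψ0 x).le]
        calc (ψ x)⁻¹ * ‖backwardMap D R v (lift X) x i‖
            ≤ (ψ x)⁻¹ * (‖v‖ + ψ x * (‖X‖ / 4)) := by gcongr
          _ = (ψ x)⁻¹ * ‖v‖ + ‖X‖ / 4 := by
            have := (hψ0 x).ne'
            field_simp
          _ ≤ _ := by gcongr)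
  have hT : ∀ X x i, T X x i = ((ψ x)⁻¹ : ℂ) * backwardMap D R v (lift X) x i := fun X x i => rfl
  have hcontr : ContractingWith (1 / 4) T := by
    refine ⟨by norm_num, LipschitzWith.of_dist_le_mul fun X Y => ?_⟩
    have h4 : ((1 / 4 : NNReal) : ℝ) = 1 / 4 := by norm_num
    rw [h4, dist_eq_norm, dist_eq_norm]
    refine (BoundedContinuousFunction.norm_le (by positivity)).2 fun x => ?_
    refine (pi_norm_le_iff_of_nonneg (by positivity)).2 fun i => ?_
    have h5 : (T X - T Y) x i =
        ((ψ x)⁻¹ : ℂ) * (backwardMap D R v (lift X) x i - backwardMap D R v (lift Y) x i) := by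
      rw [mul_sub, ← hT, ← hT]
      rfl
    have h6 : lift X - lift Y = lift (X - Y) := by
      funext x
      simp [lift, smul_sub]
    rw [h5, backwardMap_sub v (hI X i x).1 (hI Y i x).1, h6, norm_mul, norm_neg, norm_inv,
      Complex.norm_real, Real.norm_of_nonneg (hψ0 x).le]
    have h7 := (hI (X - Y) i x).2.1
    rw [inv_mul_le_iff₀ (hψ0 x)]
    linarith
  have hfix := hcontr.fixedPoint_isFixedPt
  set X := hcontr.fixedPoint T
  refine ⟨lift X, ‖X‖, hlc X, norm_nonneg _, hln X, ?_⟩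
  funext x i
  have h8 : X x i = ((ψ x)⁻¹ : ℂ) * backwardMap D R v (lift X) x i := by
    rw [← hT, hfix.eq]
  have h9 : (ψ x : ℂ) ≠ 0 := Complex.ofReal_ne_zero.2 (hψ0 x).ne'
  show (ψ x : ℂ) * X x i = _
  rw [h8, mul_inv_cancel_left₀ h9]

/-- Differentiating the fixed point equation produces the unwanted term `-dᵢ vᵢ`, which `hv`
removes: a non-zero limit is prescribed only where the rate vanishes identically. The bound is
confined to `x ≥ 0` because `ψ` may be unbounded towards `-∞`. -/
theorem IsBackwardStable.exists_solution (h : IsBackwardStable D d R) (v : ι → ℂ)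
    (hv : ∀ i x, d i x * v i = 0) :
    ∃ Z : ℝ → ι → ℂ,
      (∀ x i, HasDerivAt (fun s => Z s i) (d i x * Z x i + (R x).mulVec (Z x) i) x) ∧
      (∃ N : ℝ, ∀ x, 0 ≤ x → ∀ i, ‖Z x i‖ ≤ N) ∧
      ∀ i, (∀ x, d i x = 0) → Tendsto (fun x => Z x i) atTop (𝓝 (v i)) := by
  obtain ⟨ψ, ρ, hρ, hψ, ⟨c, hc, hψc⟩, hrow⟩ := h.exists_weight
  obtain ⟨Z, N, hZc, hN, hZN, hfix⟩ := h.exists_fixed v hρ hψ hc hψc hrow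
  have hψ0 : ∀ x, 0 < ψ x := fun x => hc.trans_le (hψc x)
  have hI := h.backward_integral hρ hψ hψ0 hrow hZc hN hZN
  have hE : ∀ x i, Z x i = v i - (Real.exp (D i x) : ℂ) *
      ∫ s in Set.Ioi x, backwardIntegrand D R Z i s := fun x i => congrFun (congrFun hfix x) i
  refine ⟨Z, fun x i => ?_, ⟨ψ 0 * N, fun x hx i => (hZN x i).trans ?_⟩, fun i hi => ?_⟩
  · have h1 : (fun s => Z s i) = fun s => v i - (Real.exp (D i s) : ℂ) *
      ∫ s in Set.Ioi s, backwardIntegrand D R Z i s := funext fun s => hE s i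
    rw [h1]
    have h2 : HasDerivAt (fun s => ((Real.exp (D i s) : ℝ) : ℂ))
        ((Real.exp (D i x) * d i x : ℝ) : ℂ) x := ((h.hasDerivAt i x).exp).ofReal_comp
    refine ((h2.mul (hI i x).2.2).const_sub (v i)).congr_deriv ?_
    have h3 : (Real.exp (D i x) : ℂ) * backwardIntegrand D R Z i x = (R x).mulVec (Z x) i := by
      rw [backwardIntegrand, ← mul_assoc, ← Complex.ofReal_mul, ← Real.exp_add]
      simp
    have h4 := hv i x
    rw [mul_neg, h3, hE x i]
    push_cast
    linear_combination -h4
  · have : Antitone ψ := antitone_of_hasDerivAt_nonpos hψ fun x =>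
      neg_nonpos.2 (by have := hρ x; have := hψ0 x; positivity)
    exact mul_le_mul_of_nonneg_right (this hx) hN
  -- With zero rate the exponential prefactor is constant, so the correction to `v i` is a multiple
  -- of the tail of a convergent integral.
  · have hconst : ∀ x, D i x = D i 0 := fun x =>
      is_const_of_deriv_eq_zero (fun x => (h.hasDerivAt i x).differentiableAt)
        (fun x => by rw [(h.hasDerivAt i x).deriv, hi]) x 0
    have h1 := MeasureTheory.intervalIntegral_tendsto_integral_Ioi 0 (hI i 0).1 tendsto_id
    have h2 : (fun x => Z x i) = fun x => v i - (Real.exp (D i 0) : ℂ) *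
        ((∫ s in Set.Ioi 0, backwardIntegrand D R Z i s) -
          ∫ s in (0 : ℝ)..x, backwardIntegrand D R Z i s) := by
      funext x
      rw [hE x i, hconst x, ← intervalIntegral.integral_Ioi_sub_Ioi' (hI i 0).1 (hI i x).1]
      ring
    rw [h2]
    have h3 := ((h1.const_sub (∫ s in Set.Ioi 0, backwardIntegrand D R Z i s)).const_mul
      (Real.exp (D i 0) : ℂ)).const_sub (v i)
    simpa using h3

end Existence

/-! ### Decay of the vortex profile. -/

theorem IsVortexProfile.continuousOn {m : ℕ} {μ : ℝ} {w : ℝ → ℝ} (hw : IsVortexProfile m μ w) :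
    ContinuousOn w (Set.Ioi 0) := by
  obtain ⟨w₁, w₂, h⟩ := hw.ode
  exact fun r hr => (h r hr).1.continuousAt.continuousWithinAt

/-- For large `r` the equation reads `(r w')' = r Q w` with `Q ≥ 1`. So `r w'` increases; it cannot
become positive, since `w ≥ 0` tends to `0`, and therefore `0 ≤ -w' ≤ C / r`. Then `w'² - w²`
decreases to `0`, hence is non-negative, and `w ≤ -w' ≤ C / r`. The true decay is much faster, but
this rate suffices. -/
theorem IsVortexProfile.decay {m : ℕ} {μ : ℝ} {w : ℝ → ℝ} (hw : IsVortexProfile m μ w) :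
    ∃ C : ℝ, ∀ᶠ r in atTop, w r ≤ C / r := by
  obtain ⟨w₁, w₂, h⟩ := hw.ode
  -- For `r ≥ ρ` one has `r² ≥ r ≥ 1 + 2 |μ|`, hence `Q r ≥ 1`.
  set ρ : ℝ := 1 + 2 * |μ| with hρ
  have hρ1 : 1 ≤ ρ := by have := abs_nonneg μ; linarith
  set Q : ℝ → ℝ := fun r => (m : ℝ) ^ 2 / r ^ 2 + r ^ 2 + 2 * |w r| ^ 2 - 2 * μ with hQ
  have hpos : ∀ r, ρ ≤ r → 0 < r := fun r hr => by linarith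
  have hQ1 : ∀ r, ρ ≤ r → 1 ≤ Q r := by
    intro r hr
    have h1 : r ≤ r ^ 2 := by nlinarith
    have h2 : 0 ≤ (m : ℝ) ^ 2 / r ^ 2 := by positivity
    have h3 : 0 ≤ |w r| ^ 2 := by positivity
    have h4 := neg_abs_le μ
    have h5 := le_abs_self μ
    simp only [hQ]
    linarith
  have hw2 : ∀ r, ρ ≤ r → w₂ r = Q r * w r - w₁ r / r := by
    intro r hr
    have := (h r (hpos r hr)).2.2
    simp only [hQ]
    linarith
  have hF : ∀ r, ρ ≤ r → HasDerivAt (fun r => r * w₁ r) (r * (Q r * w r)) r := by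
    intro r hr
    refine ((hasDerivAt_id r).mul (h r (hpos r hr)).2.1).congr_deriv ?_
    have := (hpos r hr).ne'
    rw [hw2 r hr]
    simp only [id]
    field_simp
    ring
  have hFmono : MonotoneOn (fun r => r * w₁ r) (Set.Ici ρ) := by
    refine monotoneOn_of_deriv_nonneg (convex_Ici ρ)
      (fun r hr => (hF r hr).continuousAt.continuousWithinAt)
      (fun r hr => (hF r (interior_subset hr)).differentiableAt.differentiableWithinAt) ?_
    intro r hr
    have hr' : ρ ≤ r := interior_subset hr
    rw [(hF r hr').deriv]
    have h1 := hw.nonneg r (hpos r hr')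
    have h2 := hQ1 r hr'
    have h3 := hpos r hr'
    positivity
  have hneg : ∀ r, ρ ≤ r → w₁ r ≤ 0 := by
    intro r hr
    by_contra! hlt
    have hgt : ∀ s, r ≤ s → 0 < w₁ s := by
      intro s hs
      have h1 := hFmono hr (hr.trans hs : ρ ≤ s) hs
      have h2 : 0 < r * w₁ r := mul_pos (hpos r hr) hlt
      exact pos_of_mul_pos_right (h2.trans_le h1) (hpos s (hr.trans hs)).le
    have hmono : StrictMonoOn w (Set.Ici r) := by
      refine strictMonoOn_of_deriv_pos (convex_Ici r)
        (fun s hs => (h s (hpos s (hr.trans hs))).1.continuousAt.continuousWithinAt) ?_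
      intro s hs
      have hs' : r ≤ s := interior_subset hs
      rw [(h s (hpos s (hr.trans hs'))).1.deriv]
      exact hgt s hs'
    have h1 : w r < w (r + 1) := hmono Set.self_mem_Ici (by simp) (by linarith)
    have h2 : w (r + 1) ≤ 0 := by
      refine ge_of_tendsto hw.tendsto_infty (eventually_atTop.2 ⟨r + 1, fun s hs => ?_⟩)
      exact hmono.monotoneOn (by simp) (by simp; linarith) hs
    have h3 := hw.nonneg r (hpos r hr)
    linarith
  set C : ℝ := -(ρ * w₁ ρ) with hC
  have hw1C : ∀ r, ρ ≤ r → -w₁ r ≤ C / r := by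
    intro r hr
    rw [le_div_iff₀ (hpos r hr)]
    have := hFmono Set.self_mem_Ici hr hr
    simp only at this
    linarith
  have hw1lim : Tendsto w₁ atTop (𝓝 0) := by
    have h1 : Tendsto (fun r : ℝ => -(C / r)) atTop (𝓝 (-0)) :=
      (tendsto_const_nhds.div_atTop tendsto_id).neg
    rw [neg_zero] at h1
    refine tendsto_of_tendsto_of_tendsto_of_le_of_le' h1 tendsto_const_nhds
      (eventually_atTop.2 ⟨ρ, fun r hr => ?_⟩) (eventually_atTop.2 ⟨ρ, hneg⟩)
    linarith [hw1C r hr]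
  have hH : ∀ r, ρ ≤ r → HasDerivAt (fun r => w₁ r ^ 2 - w r ^ 2)
      (2 * w₁ r * (w₂ r - w r)) r := by
    intro r hr
    refine (((h r (hpos r hr)).2.1.pow 2).sub ((h r (hpos r hr)).1.pow 2)).congr_deriv ?_
    push_cast
    ring
  have hHanti : AntitoneOn (fun r => w₁ r ^ 2 - w r ^ 2) (Set.Ici ρ) := by
    refine antitoneOn_of_deriv_nonpos (convex_Ici ρ)
      (fun r hr => (hH r hr).continuousAt.continuousWithinAt)
      (fun r hr => (hH r (interior_subset hr)).differentiableAt.differentiableWithinAt) ?_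
    intro r hr
    have hr' : ρ ≤ r := interior_subset hr
    rw [(hH r hr').deriv, hw2 r hr']
    have h1 := hw.nonneg r (hpos r hr')
    have h2 := hQ1 r hr'
    have h3 := hneg r hr'
    have h4 : w₁ r / r ≤ 0 := div_nonpos_of_nonpos_of_nonneg h3 (hpos r hr').le
    have h5 : 0 ≤ (Q r - 1) * w r := mul_nonneg (by linarith) h1
    nlinarith
  have hHlim : Tendsto (fun r => w₁ r ^ 2 - w r ^ 2) atTop (𝓝 0) := by
    simpa using (hw1lim.pow 2).sub (hw.tendsto_infty.pow 2)
  refine ⟨C, eventually_atTop.2 ⟨ρ, fun r hr => ?_⟩⟩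
  have h1 : 0 ≤ w₁ r ^ 2 - w r ^ 2 :=
    le_of_tendsto hHlim (eventually_atTop.2 ⟨r, fun s hs => hHanti hr (hr.trans hs : ρ ≤ s) hs⟩)
  have h2 : w r ≤ -w₁ r := by
    have h3 := hneg r hr
    by_contra! h4
    nlinarith
  exact h2.trans (hw1C r hr)

theorem IsVortexProfile.sq_decay {m : ℕ} {μ : ℝ} {w : ℝ → ℝ} (hw : IsVortexProfile m μ w) :
    ∃ C : ℝ, ∀ᶠ r in atTop, w r ^ 2 ≤ C / r ^ 2 := by
  obtain ⟨C, hC⟩ := hw.decay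
  refine ⟨C ^ 2, ?_⟩
  filter_upwards [hC, eventually_gt_atTop 0] with r h1 h2
  rw [← div_pow]
  exact pow_le_pow_left₀ (hw.nonneg r h2) h1 2

/-- The bootstrap tool: forcing of size at most `M d` yields a solution of size at most `M`. It is
`norm_le_of_backward` with `C = 0` and `4 M` for `M`. -/
theorem norm_le_of_backward_of_le {f g : ℝ → ℂ} {D d : ℝ → ℝ} {M x₀ : ℝ} (hM : 0 ≤ M)
    (hD : ∀ x, HasDerivAt D (d x) x) (hd : ∀ x, 0 ≤ d x)
    (hf : ∀ x, x₀ ≤ x → HasDerivAt f (d x * f x + g x) x)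
    (hg : ∀ x, x₀ ≤ x → ‖g x‖ ≤ M * d x)
    (hlim : Tendsto (fun x => (Real.exp (-D x) : ℂ) * f x) atTop (𝓝 0)) (x : ℝ) (hx : x₀ ≤ x) :
    ‖f x‖ ≤ M := by
  have := norm_le_of_backward (M := 4 * M) (C := 0) (by positivity) le_rfl hD hd hf
    (fun x hx => (hg x hx).trans (by linarith)) hlim x hx
  linarith

/-- The element of `Λ² ℂ⁴` with the given coordinates. -/
def bivector (u₀₁ u₀₂ u₀₃ u₁₂ u₁₃ u₂₃ : ℂ) : Pair → ℂ := fun p =>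
  !![0, u₀₁, u₀₂, u₀₃; 0, 0, u₁₂, u₁₃; 0, 0, 0, u₂₃; 0, 0, 0, 0] p.1.1 p.1.2

/-! ### The exterior system near `r = 0`, in the variable `x = -log r`. -/

section AtZero

/-- The part of `coefPlus` that is bounded near zero. -/
def regPlus (μ : ℝ) (w : ℝ → ℝ) (lam : ℂ) (r : ℝ) : ℂ :=
  (r : ℂ) ^ 2 - 2 * μ - 2 * Complex.I * lam + 4 * (w r : ℂ) ^ 2

/-- The part of `coefMinus` that is bounded near zero. -/
def regMinus (μ : ℝ) (w : ℝ → ℝ) (lam : ℂ) (r : ℝ) : ℂ :=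
  (r : ℂ) ^ 2 - 2 * μ + 2 * Complex.I * lam + 4 * (w r : ℂ) ^ 2

theorem natAbs_cast_sq (k : ℤ) : ((k.natAbs : ℕ) : ℂ) ^ 2 = (k : ℂ) ^ 2 := by
  rw [Nat.cast_natAbs, ← Int.cast_pow, sq_abs, Int.cast_pow]

theorem coefPlus_eq_regPlus (m : ℕ) (μ : ℝ) (w : ℝ → ℝ) (j : ℤ) (lam : ℂ) (r : ℝ) :
    coefPlus m μ w j lam r = ((j + m).natAbs : ℂ) ^ 2 / (r : ℂ) ^ 2 + regPlus μ w lam r := by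
  rw [natAbs_cast_sq]
  simp only [coefPlus, kPlus, regPlus]
  push_cast
  ring

theorem coefMinus_eq_regMinus (m : ℕ) (μ : ℝ) (w : ℝ → ℝ) (j : ℤ) (lam : ℂ) (r : ℝ) :
    coefMinus m μ w j lam r = ((j - m).natAbs : ℂ) ^ 2 / (r : ℂ) ^ 2 + regMinus μ w lam r := by
  rw [natAbs_cast_sq]
  simp only [coefMinus, kMinus, regMinus]
  push_cast
  ring

/-- The rates of the diagonalized exterior system in the variable `-log r`. -/
def zeroRate (a b : ℕ) : Fin 6 → ℝ :=
  ![0, 2 * b + 1, 2 * a + 1, 2 * (a + b) + 2, a + b + 1, a + b + 1]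

/-- The perturbation of the diagonalized exterior system near zero, divided by `r`. -/
def zeroPerturbation (k₁ k₂ c : ℂ) : Matrix (Fin 6) (Fin 6) ℂ :=
  !![0, -1, -1, 0, 0, 0;
     -k₂, 0, 0, -1, 0, 0;
     -k₁, 0, 0, -1, 0, 0;
     0, -k₁, -k₂, 0, c, -c;
     -c, 0, 0, 0, 0, 0;
     c, 0, 0, 0, 0, 0]

theorem zeroRate_nonneg (a b : ℕ) (i : Fin 6) : 0 ≤ zeroRate a b i := by
  fin_cases i <;> simp [zeroRate] <;> positivity

theorem norm_zeroPerturbation_le {k₁ k₂ c : ℂ} {K : ℝ} (h1 : ‖k₁‖ ≤ K) (h2 : ‖k₂‖ ≤ K)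
    (hc : ‖c‖ ≤ K) (hK : 1 ≤ K) (i k : Fin 6) : ‖zeroPerturbation k₁ k₂ c i k‖ ≤ K := by
  have h0 : 0 ≤ K := by linarith
  fin_cases i <;> fin_cases k <;> simp [zeroPerturbation] <;> assumption

variable {m : ℕ} {μ : ℝ} {w : ℝ → ℝ}

theorem IsVortexProfile.exists_reg_bound (hw : IsVortexProfile m μ w) (lam : ℂ) :
    ∃ K : ℝ, 1 ≤ K ∧ ∀ᶠ x : ℝ in atTop, ‖regPlus μ w lam (Real.exp (-x))‖ ≤ K ∧
      ‖regMinus μ w lam (Real.exp (-x))‖ ≤ K ∧ ‖2 * (w (Real.exp (-x)) : ℂ) ^ 2‖ ≤ K := by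
  obtain ⟨C, hC⟩ := hw.bounded_zero
  have ht : Tendsto (fun x : ℝ => Real.exp (-x)) atTop (𝓝[>] 0) :=
    tendsto_nhdsWithin_iff.2 ⟨Real.tendsto_exp_neg_atTop_nhds_zero,
      Eventually.of_forall fun x => Real.exp_pos _⟩
  refine ⟨1 + 2 * |μ| + 2 * ‖lam‖ + 4 * C ^ 2 + 1, ?_, ?_⟩
  · have := abs_nonneg μ
    have := norm_nonneg lam
    have := sq_nonneg C
    linarith
  filter_upwards [ht.eventually hC, eventually_ge_atTop 0] with x hx hx0
  set r := Real.exp (-x)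
  have hr0 : 0 < r := Real.exp_pos _
  have hr1 : r ≤ 1 := Real.exp_le_one_iff.2 (by linarith)
  have h1 : ‖(r : ℂ) ^ 2‖ ≤ 1 := by
    rw [norm_pow, Complex.norm_real, Real.norm_of_nonneg hr0.le]
    exact pow_le_one₀ hr0.le hr1
  have h2 : ‖(w r : ℂ) ^ 2‖ ≤ C ^ 2 := by
    rw [norm_pow, Complex.norm_real]
    exact pow_le_pow_left₀ (norm_nonneg _) hx 2
  have h3 : ‖(2 * μ : ℂ)‖ = 2 * |μ| := by simp
  have h4 : ‖2 * Complex.I * lam‖ = 2 * ‖lam‖ := by simp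
  have h5 : ‖4 * (w r : ℂ) ^ 2‖ ≤ 4 * C ^ 2 := by
    rw [norm_mul]; norm_num; simpa using h2
  have h6 := abs_nonneg μ
  have h7 := norm_nonneg lam
  have h8 := sq_nonneg C
  refine ⟨?_, ?_, ?_⟩
  · refine (norm_add_le _ _).trans ?_
    have := norm_sub_le ((r : ℂ) ^ 2 - 2 * μ) (2 * Complex.I * lam)
    have := norm_sub_le ((r : ℂ) ^ 2) (2 * μ)
    linarith
  · refine (norm_add_le _ _).trans ?_
    have := norm_add_le ((r : ℂ) ^ 2 - 2 * μ) (2 * Complex.I * lam)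
    have := norm_sub_le ((r : ℂ) ^ 2) (2 * μ)
    linarith
  · rw [norm_mul]
    have : ‖(2 : ℂ)‖ = 2 := by simp
    rw [this]
    linarith

/-- The perturbation of the diagonalized exterior system in the variable `x = -log r`. -/
def zeroRest (μ : ℝ) (w : ℝ → ℝ) (lam : ℂ) (x : ℝ) : Matrix (Fin 6) (Fin 6) ℂ :=
  (Real.exp (-x) : ℂ) • zeroPerturbation (regPlus μ w lam (Real.exp (-x)))
    (regMinus μ w lam (Real.exp (-x))) (2 * (w (Real.exp (-x)) : ℂ) ^ 2)

/-- The free exterior solutions behave like `r^(±a±b)`; relative to `r^(a+b)` this gives the rates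
`0, 2b, 2a, 2(a+b)`, and `a + b + 1` for the coordinates `01` and `23`. Derivative components are
left unscaled, which adds `1` per derivative. This keeps the non-zero rates at least `1` even if `a`
or `b` is `0`, where a logarithm occurs, and leaves a factor `r = exp (-x)` before the whole
perturbation. Boundedness of `w` near `0` is all that is needed. -/
theorem IsVortexProfile.isBackwardStable_zero (hw : IsVortexProfile m μ w) (lam : ℂ) (a b : ℕ) :
    IsBackwardStable (fun i x => zeroRate a b i * x) (fun i _ => zeroRate a b i)
      (zeroRest μ w lam) where
  hasDerivAt i x := by simpa using (hasDerivAt_id x).const_mul (zeroRate a b i)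
  nonneg i _ := zeroRate_nonneg a b i
  continuous_diag _ := continuous_const
  continuous_rest i k := by
    have hwc : Continuous fun x : ℝ => (w (Real.exp (-x)) : ℂ) := Complex.continuous_ofReal.comp
      (hw.continuousOn.comp_continuous (by fun_prop) fun x => Real.exp_pos _)
    have h1 : Continuous fun x : ℝ => regPlus μ w lam (Real.exp (-x)) := by
      unfold regPlus; fun_prop
    have h2 : Continuous fun x : ℝ => regMinus μ w lam (Real.exp (-x)) := by
      unfold regMinus; fun_prop
    have h3 : Continuous fun x : ℝ => zeroPerturbation (regPlus μ w lam (Real.exp (-x)))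
        (regMinus μ w lam (Real.exp (-x))) (2 * (w (Real.exp (-x)) : ℂ) ^ 2) i k := by
      fin_cases i <;> fin_cases k <;> simp [zeroPerturbation] <;> fun_prop
    simp only [zeroRest, Matrix.smul_apply, smul_eq_mul]
    fun_prop
  bound i k := by
    obtain ⟨K, hK, h⟩ := hw.exists_reg_bound lam
    refine ⟨K, ?_⟩
    filter_upwards [h] with x hx
    have h1 := norm_zeroPerturbation_le hx.1 hx.2.1 hx.2.2 hK i k
    have h2 : 0 ≤ zeroRate a b i / (4 * Fintype.card (Fin 6)) :=
      div_nonneg (zeroRate_nonneg a b i) (by positivity)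
    rw [zeroRest, Matrix.smul_apply, smul_eq_mul, norm_mul, Complex.norm_real,
      Real.norm_of_nonneg (Real.exp_nonneg _), mul_comm]
    exact le_add_of_le_of_nonneg (mul_le_mul_of_nonneg_right h1 (Real.exp_nonneg _)) h2

theorem zeroPerturbation_mulVec (k₁ k₂ c : ℂ) (z : Fin 6 → ℂ) :
    (zeroPerturbation k₁ k₂ c).mulVec z =
      ![-z 1 - z 2, -k₂ * z 0 - z 3, -k₁ * z 0 - z 3,
        -k₁ * z 1 - k₂ * z 2 + c * z 4 - c * z 5, -c * z 0, c * z 0] := by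
  funext i
  fin_cases i <;>
    simp [zeroPerturbation, Matrix.mulVec, dotProduct, Fin.sum_univ_succ] <;> ring

theorem hasDerivAt_ofReal_pow (n : ℕ) {r : ℝ} (hr : 0 < r) :
    HasDerivAt (fun s : ℝ => (s : ℂ) ^ n) (n * (r : ℂ) ^ n / r) r := by
  have h := (Complex.ofRealCLM.hasDerivAt (x := r)).pow n
  have hr' : (r : ℂ) ≠ 0 := Complex.ofReal_ne_zero.2 hr.ne'
  refine h.congr_deriv ?_
  rcases n with _ | n
  · simp
  · simp only [Complex.ofRealCLM_apply, Nat.add_sub_cancel]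
    field_simp
    push_cast
    simp [pow_succ]

/-- The bivector with given coordinates in the basis that diagonalizes the exterior system
near zero. -/
def zeroBivector (a b : ℕ) (r : ℝ) (z : Fin 6 → ℂ) : Pair → ℂ :=
  bivector ((r : ℂ) ^ (a + b) * z 4) ((r : ℂ) ^ (a + b) * z 0)
    ((r : ℂ) ^ (a + b) * (z 1 + b * z 0 / r)) ((r : ℂ) ^ (a + b) * (z 2 + a * z 0 / r))
    ((r : ℂ) ^ (a + b) * (z 3 + b * z 2 / r + a * z 1 / r + a * b * z 0 / (r : ℂ) ^ 2))
    ((r : ℂ) ^ (a + b) * z 5)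

/-- The coordinates replace `y₊'` by `y₊' - (a / r) y₊` and `y₋'` by `y₋' - (b / r) y₋`, which
vanish on `r^a` and `r^b`; this diagonalizes the singular part. This direction serves existence, and
`hasDerivAt_zeroCoord`, its inverse, serves uniqueness. -/
theorem hasDerivAt_zeroBivector (m : ℕ) (μ : ℝ) (w : ℝ → ℝ) (j : ℤ) (lam : ℂ) {z : ℝ → Fin 6 → ℂ}
    {r : ℝ} (hr : 0 < r)
    (hz : ∀ i, HasDerivAt (fun s => z s i)
      (-(zeroRate (j + m).natAbs (j - m).natAbs i * z r i / r +
        (zeroPerturbation (regPlus μ w lam r) (regMinus μ w lam r)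
          (2 * (w r : ℂ) ^ 2)).mulVec (z r) i)) r) :
    HasDerivAt (fun s => zeroBivector (j + m).natAbs (j - m).natAbs s (z s))
      ((exteriorMatrix (B m μ w j lam r)).mulVec
        (zeroBivector (j + m).natAbs (j - m).natAbs r (z r))) r := by
  have hr' : (r : ℂ) ≠ 0 := Complex.ofReal_ne_zero.2 hr.ne'
  rw [hasDerivAt_exterior_iff, coefPlus_eq_regPlus, coefMinus_eq_regMinus]
  set a := (j + m).natAbs
  set b := (j - m).natAbs
  rw [zeroPerturbation_mulVec] at hz
  have h0 := hz 0
  have h1 := hz 1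
  have h2 := hz 2
  have h3 := hz 3
  have h4 := hz 4
  have h5 := hz 5
  simp [zeroRate] at h0 h1 h2 h3 h4 h5
  have hp := hasDerivAt_ofReal_pow (a + b) hr
  have hi : HasDerivAt (fun s : ℝ => ((s : ℂ))⁻¹) (-1 / (r : ℂ) ^ 2) r := by
    simpa using (Complex.ofRealCLM.hasDerivAt (x := r)).fun_inv hr'
  have hi2 : HasDerivAt (fun s : ℝ => (((s : ℂ)) ^ 2)⁻¹) (-2 / (r : ℂ) ^ 3) r := by
    refine (((Complex.ofRealCLM.hasDerivAt (x := r)).pow 2).fun_inv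
      (by simpa using hr')).congr_deriv ?_
    simp
    field_simp
  simp only [zeroBivector, bivector, div_eq_mul_inv]
  simp
  refine ⟨?_, ?_, ?_, ?_, ?_, ?_⟩
  · refine (hp.mul h4).congr_deriv ?_
    push_cast
    field_simp
    ring
  · refine (hp.mul h0).congr_deriv ?_
    push_cast
    field_simp
    ring
  · refine (hp.mul (h1.add ((h0.const_mul (b : ℂ)).mul hi))).congr_deriv ?_
    push_cast
    simp
    field_simp
    ring
  · refine (hp.mul (h2.add ((h0.const_mul (a : ℂ)).mul hi))).congr_deriv ?_
    push_cast
    simp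
    field_simp
    ring
  · refine (hp.mul (((h3.add ((h2.const_mul (b : ℂ)).mul hi)).add
      ((h1.const_mul (a : ℂ)).mul hi)).add
      ((h0.const_mul (a * b : ℂ)).mul hi2))).congr_deriv ?_
    push_cast
    simp
    field_simp
    ring
  · refine (hp.mul h5).congr_deriv ?_
    push_cast
    field_simp
    ring

theorem tendsto_neg_log_nhdsGT_zero : Tendsto (fun r : ℝ => -Real.log r) (𝓝[>] 0) atTop :=
  tendsto_neg_atBot_atTop.comp Real.tendsto_log_nhdsGT_zero

theorem tendsto_ofReal_mul_of_bounded {f : ℝ → ℂ} {N : ℝ} (hf : ∀ᶠ r in 𝓝[>] (0 : ℝ), ‖f r‖ ≤ N) :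
    Tendsto (fun r : ℝ => (r : ℂ) * f r) (𝓝[>] 0) (𝓝 0) := by
  have h0 : Tendsto (fun r : ℝ => (r : ℂ)) (𝓝[>] 0) (𝓝 0) := by
    have : Tendsto (fun r : ℝ => (r : ℂ)) (𝓝 0) (𝓝 ((0 : ℝ) : ℂ)) :=
      Complex.continuous_ofReal.tendsto 0
    simpa using this.mono_left nhdsWithin_le_nhds
  exact h0.zero_mul_isBoundedUnder_le ⟨N, by simpa using hf⟩

theorem exists_isSolutionAtZero (hw : IsVortexProfile m μ w) (j : ℤ) (lam : ℂ) :
    ∃ U, IsSolutionAtZero m μ w j lam U := by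
  set a := (j + m).natAbs with ha
  set b := (j - m).natAbs with hb
  obtain ⟨Z, hZ, ⟨N, hN⟩, hlim⟩ := (hw.isBackwardStable_zero lam a b).exists_solution
    ![1, 0, 0, 0, 0, 0] (by
      intro i _
      fin_cases i <;> simp [zeroRate])
  set z : ℝ → Fin 6 → ℂ := fun r => Z (-Real.log r) with hz
  have hz' : ∀ r : ℝ, 0 < r → ∀ i, HasDerivAt (fun s => z s i)
      (-(zeroRate a b i * z r i / r +
        (zeroPerturbation (regPlus μ w lam r) (regMinus μ w lam r)
          (2 * (w r : ℂ) ^ 2)).mulVec (z r) i)) r := by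
    intro r hr i
    have hr' : (r : ℂ) ≠ 0 := Complex.ofReal_ne_zero.2 hr.ne'
    refine ((hZ (-Real.log r) i).scomp r (Real.hasDerivAt_log hr.ne').fun_neg).congr_deriv ?_
    rw [zeroRest, neg_neg, Real.exp_log hr, Matrix.smul_mulVec, Pi.smul_apply, smul_eq_mul,
      Complex.real_smul]
    push_cast
    field_simp
    rfl
  have hbd : ∀ i, ∀ᶠ r in 𝓝[>] (0 : ℝ), ‖z r i‖ ≤ N := fun i =>
    (tendsto_neg_log_nhdsGT_zero.eventually_ge_atTop 0).mono fun r hr => hN _ hr i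
  have hsm : ∀ i, Tendsto (fun r : ℝ => (r : ℂ) * z r i) (𝓝[>] 0) (𝓝 0) := fun i =>
    tendsto_ofReal_mul_of_bounded (hbd i)
  have h0 : Tendsto (fun r => z r 0) (𝓝[>] 0) (𝓝 1) :=
    (hlim 0 (by simp [zeroRate])).comp tendsto_neg_log_nhdsGT_zero
  have hr0 : Tendsto (fun r : ℝ => (r : ℂ)) (𝓝[>] 0) (𝓝 0) := by
    simpa using tendsto_ofReal_mul_of_bounded (f := fun _ => 1) (N := 1) (by simp)
  refine ⟨fun r => zeroBivector a b r (z r), fun r hr =>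
    hasDerivAt_zeroBivector m μ w j lam hr (hz' r hr), ?_⟩
  rw [forall_pair, ← ha, ← hb]
  have hpos : ∀ᶠ r : ℝ in 𝓝[>] 0, (r : ℂ) ≠ 0 :=
    eventually_mem_nhdsWithin.mono fun r hr => Complex.ofReal_ne_zero.2 (ne_of_gt hr)
  simp [zeroBivector, bivector, wedge]
  refine ⟨?_, ?_, ?_, ?_, ?_, ?_⟩
  · refine (hsm 4).congr' ?_
    filter_upwards [hpos] with r hr
    field_simp
  · refine h0.congr' ?_
    filter_upwards [hpos] with r hr
    field_simp
  · have := (hsm 1).add (h0.const_mul (b : ℂ))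
    rw [zero_add, mul_one] at this
    refine this.congr' ?_
    filter_upwards [hpos] with r hr
    field_simp
  · have := (hsm 2).add (h0.const_mul (a : ℂ))
    rw [zero_add, mul_one] at this
    refine this.congr' ?_
    filter_upwards [hpos] with r hr
    field_simp
  · have := (((hr0.mul (hsm 3)).add ((hsm 2).const_mul (b : ℂ))).add
      ((hsm 1).const_mul (a : ℂ))).add (h0.const_mul (a * b : ℂ))
    simp only [mul_zero, zero_add, mul_one] at this
    refine this.congr' ?_
    filter_upwards [hpos] with r hr
    field_simp
  · refine (hsm 5).congr' ?_
    filter_upwards [hpos] with r hr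
    field_simp

/-- The coordinates of a bivector in the basis that diagonalizes the exterior system near zero. -/
def zeroCoord (a b : ℕ) (r : ℝ) (u : Pair → ℂ) : Fin 6 → ℂ :=
  ![((r : ℂ) ^ (a + b))⁻¹ * u (pair 0 2),
    ((r : ℂ) ^ (a + b))⁻¹ * (u (pair 0 3) - b * u (pair 0 2) * (r : ℂ)⁻¹),
    ((r : ℂ) ^ (a + b))⁻¹ * (u (pair 1 2) - a * u (pair 0 2) * (r : ℂ)⁻¹),
    ((r : ℂ) ^ (a + b))⁻¹ * (u (pair 1 3) - b * u (pair 1 2) * (r : ℂ)⁻¹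
      - a * u (pair 0 3) * (r : ℂ)⁻¹ + a * b * u (pair 0 2) * ((r : ℂ) ^ 2)⁻¹),
    ((r : ℂ) ^ (a + b))⁻¹ * u (pair 0 1),
    ((r : ℂ) ^ (a + b))⁻¹ * u (pair 2 3)]

theorem eq_zero_of_zeroCoord_eq_zero {a b : ℕ} {r : ℝ} (hr : 0 < r) {u : Pair → ℂ}
    (h : zeroCoord a b r u = 0) : u = 0 := by
  have hr' : (r : ℂ) ≠ 0 := Complex.ofReal_ne_zero.2 hr.ne'
  have h0 := congrFun h 0
  have h1 := congrFun h 1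
  have h2 := congrFun h 2
  have h3 := congrFun h 3
  have h4 := congrFun h 4
  have h5 := congrFun h 5
  simp [zeroCoord, hr'] at h0 h1 h2 h3 h4 h5
  simp [h0] at h1 h2
  simp [h0, h1, h2] at h3
  funext p
  revert p
  rw [forall_pair]
  exact ⟨h4, h0, h1, h2, h3, h5⟩

theorem hasDerivAt_zeroCoord (m : ℕ) (μ : ℝ) (w : ℝ → ℝ) (j : ℤ) (lam : ℂ) {U : ℝ → Pair → ℂ}
    {r : ℝ} (hr : 0 < r)
    (hU : HasDerivAt U ((exteriorMatrix (B m μ w j lam r)).mulVec (U r)) r) (i : Fin 6) :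
    HasDerivAt (fun s => zeroCoord (j + m).natAbs (j - m).natAbs s (U s) i)
      (-(zeroRate (j + m).natAbs (j - m).natAbs i *
          zeroCoord (j + m).natAbs (j - m).natAbs r (U r) i / r +
        (zeroPerturbation (regPlus μ w lam r) (regMinus μ w lam r)
          (2 * (w r : ℂ) ^ 2)).mulVec (zeroCoord (j + m).natAbs (j - m).natAbs r (U r)) i)) r := by
  have hr' : (r : ℂ) ≠ 0 := Complex.ofReal_ne_zero.2 hr.ne'
  rw [hasDerivAt_exterior_iff, coefPlus_eq_regPlus, coefMinus_eq_regMinus] at hU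
  obtain ⟨h01, h02, h03, h12, h13, h23⟩ := hU
  set a := (j + m).natAbs
  set b := (j - m).natAbs
  have hp : HasDerivAt (fun s : ℝ => ((s : ℂ) ^ (a + b))⁻¹)
      (-(((a + b : ℕ) : ℂ) / ((r : ℂ) ^ (a + b) * r))) r := by
    refine ((hasDerivAt_ofReal_pow (a + b) hr).fun_inv (pow_ne_zero _ hr')).congr_deriv ?_
    field_simp
  have hi : HasDerivAt (fun s : ℝ => ((s : ℂ))⁻¹) (-1 / (r : ℂ) ^ 2) r := by
    simpa using (Complex.ofRealCLM.hasDerivAt (x := r)).fun_inv hr'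
  have hi2 : HasDerivAt (fun s : ℝ => (((s : ℂ)) ^ 2)⁻¹) (-2 / (r : ℂ) ^ 3) r := by
    refine (((Complex.ofRealCLM.hasDerivAt (x := r)).pow 2).fun_inv
      (by simpa using hr')).congr_deriv ?_
    simp
    field_simp
  rw [zeroPerturbation_mulVec]
  revert i
  simp only [Fin.forall_fin_succ]
  simp [zeroCoord, zeroRate]
  refine ⟨?_, ?_, ?_, ?_, ?_, ?_⟩
  · refine (hp.mul h02).congr_deriv ?_
    push_cast
    field_simp
    ring
  · refine (hp.mul (h03.sub ((h02.const_mul (b : ℂ)).mul hi))).congr_deriv ?_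
    push_cast
    simp
    field_simp
    ring
  · refine (hp.mul (h12.sub ((h02.const_mul (a : ℂ)).mul hi))).congr_deriv ?_
    push_cast
    simp
    field_simp
    ring
  · refine (hp.mul (((h13.sub ((h12.const_mul (b : ℂ)).mul hi)).sub
      ((h03.const_mul (a : ℂ)).mul hi)).add
      ((h02.const_mul (a * b : ℂ)).mul hi2))).congr_deriv ?_
    push_cast
    simp
    field_simp
    ring
  · refine (hp.mul h01).congr_deriv ?_
    push_cast
    field_simp
    ring
  · refine (hp.mul h23).congr_deriv ?_
    push_cast
    field_simp
    ring

theorem tendsto_exp_neg_nhdsGT_zero : Tendsto (fun x : ℝ => Real.exp (-x)) atTop (𝓝[>] 0) :=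
  tendsto_nhdsWithin_iff.2 ⟨Real.tendsto_exp_neg_atTop_nhds_zero,
    Eventually.of_forall fun _ => Real.exp_pos _⟩

/-- The powers of `r` by which the coordinates `zeroCoord` have to be multiplied to be small. -/
def zeroWeight : Fin 6 → ℕ := ![0, 1, 1, 2, 1, 1]

theorem tendsto_zeroCoord {a b : ℕ} {U : ℝ → Pair → ℂ}
    (hlim : ∀ p : Pair, Tendsto (fun r : ℝ =>
      ((![1, r, 1, r] p.1.1 * ![1, r, 1, r] p.1.2 / r ^ (a + b) : ℝ) : ℂ) * U r p)
      (𝓝[>] 0) (𝓝 0)) (i : Fin 6) :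
    Tendsto (fun r : ℝ => (r : ℂ) ^ zeroWeight i * zeroCoord a b r (U r) i) (𝓝[>] 0) (𝓝 0) := by
  rw [forall_pair] at hlim
  simp at hlim
  obtain ⟨h01, h02, h03, h12, h13, h23⟩ := hlim
  have hpos : ∀ᶠ r : ℝ in 𝓝[>] 0, (r : ℂ) ≠ 0 :=
    eventually_mem_nhdsWithin.mono fun r hr => Complex.ofReal_ne_zero.2 (ne_of_gt hr)
  revert i
  simp only [Fin.forall_fin_succ]
  simp [zeroCoord, zeroWeight]
  refine ⟨?_, ?_, ?_, ?_, ?_, ?_⟩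
  · exact h02
  · have := h03.sub (h02.const_mul (b : ℂ))
    simp only [mul_zero, sub_zero] at this
    refine this.congr' ?_
    filter_upwards [hpos] with r hr
    field_simp
  · have := h12.sub (h02.const_mul (a : ℂ))
    simp only [mul_zero, sub_zero] at this
    refine this.congr' ?_
    filter_upwards [hpos] with r hr
    field_simp
  · have := ((h13.sub (h12.const_mul (b : ℂ))).sub (h03.const_mul (a : ℂ))).add
      (h02.const_mul (a * b : ℂ))
    simp only [mul_zero, sub_zero, add_zero] at this
    refine this.congr' ?_
    filter_upwards [hpos] with r hr
    field_simp
  · refine h01.congr' ?_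
    filter_upwards [hpos] with r hr
    field_simp
  · refine h23.congr' ?_
    filter_upwards [hpos] with r hr
    field_simp

/-- Hence the weak decay known from the asymptotics already implies `exp (-Dᵢ) Zᵢ → 0`, as backward
integration requires. -/
theorem zeroWeight_le_zeroRate (a b : ℕ) (i : Fin 6) : (zeroWeight i : ℝ) ≤ zeroRate a b i := by
  fin_cases i <;> simp [zeroRate, zeroWeight] <;> positivity

/-- The asymptotics only give `r^(zeroWeight i) Zᵢ → 0`, so boundedness of `Z` must be gained from
the equations, one group of coordinates at a time, before `eventually_eq_zero` applies. One zero is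
enough for the uniqueness of the Evans value. -/
theorem exists_eq_zero_near_zero (hw : IsVortexProfile m μ w) (j : ℤ) (lam : ℂ)
    {U : ℝ → Pair → ℂ}
    (hU : ∀ r : ℝ, 0 < r → HasDerivAt U ((exteriorMatrix (B m μ w j lam r)).mulVec (U r)) r)
    (hlim : ∀ p : Pair, Tendsto (fun r : ℝ =>
      ((![1, r, 1, r] p.1.1 * ![1, r, 1, r] p.1.2 /
        r ^ ((j + m).natAbs + (j - m).natAbs) : ℝ) : ℂ) * U r p) (𝓝[>] 0) (𝓝 0)) :
    ∃ r : ℝ, 0 < r ∧ U r = 0 := by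
  set a := (j + m).natAbs with ha
  set b := (j - m).natAbs with hb
  set Z : ℝ → Fin 6 → ℂ := fun x => zeroCoord a b (Real.exp (-x)) (U (Real.exp (-x))) with hZdef
  have hZ : ∀ x i, HasDerivAt (fun s => Z s i)
      (zeroRate a b i * Z x i + (zeroRest μ w lam x).mulVec (Z x) i) x := by
    intro x i
    have hr := Real.exp_pos (-x)
    have h1 := hasDerivAt_zeroCoord m μ w j lam hr (hU _ hr) i
    refine (h1.scomp x ((hasDerivAt_neg x).exp)).congr_deriv ?_
    have hr' : (Real.exp (-x) : ℂ) ≠ 0 := Complex.ofReal_ne_zero.2 hr.ne'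
    rw [zeroRest, Matrix.smul_mulVec, Pi.smul_apply, smul_eq_mul, Complex.real_smul]
    simp only [hZdef, Complex.ofReal_mul, Complex.ofReal_neg, Complex.ofReal_one]
    rw [← ha, ← hb]
    field_simp
  have hL : ∀ i, Tendsto (fun x => (Real.exp (-x) : ℂ) ^ zeroWeight i * Z x i) atTop (𝓝 0) :=
    fun i => (tendsto_zeroCoord hlim i).comp tendsto_exp_neg_nhdsGT_zero
  have hD : ∀ i, Tendsto (fun x => (Real.exp (-(zeroRate a b i * x)) : ℂ) * Z x i) atTop
      (𝓝 0) := by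
    intro i
    refine squeeze_zero_norm' ?_ (tendsto_zero_iff_norm_tendsto_zero.1 (hL i))
    filter_upwards [eventually_ge_atTop 0] with x hx
    rw [norm_mul, norm_mul]
    refine mul_le_mul_of_nonneg_right ?_ (norm_nonneg _)
    rw [norm_pow, Complex.norm_real, Complex.norm_real, Real.norm_of_nonneg (Real.exp_nonneg _),
      Real.norm_of_nonneg (Real.exp_nonneg _), ← Real.exp_nat_mul, Real.exp_le_exp]
    have := mul_le_mul_of_nonneg_right (zeroWeight_le_zeroRate a b i) hx
    linarith
  obtain ⟨K, hK, hKb⟩ := hw.exists_reg_bound lam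
  have hL1 : ∀ᶠ x in atTop, ∀ i, ‖(Real.exp (-x) : ℂ) ^ zeroWeight i * Z x i‖ ≤ 1 :=
    eventually_all.2 fun i => ((hL i).norm.eventually_lt_const (by simp)).mono fun _ h => h.le
  obtain ⟨x₀, hx₀⟩ := eventually_atTop.1 (hKb.and (hL1.and (eventually_ge_atTop 0)))
  have hst := hw.isBackwardStable_zero lam a b
  have hboot : ∀ i : Fin 6, ∀ M : ℝ, 0 ≤ M → 1 ≤ zeroRate a b i →
      (∀ x, x₀ ≤ x → ‖(zeroRest μ w lam x).mulVec (Z x) i‖ ≤ M) → ∀ x, x₀ ≤ x → ‖Z x i‖ ≤ M := by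
    intro i M hM hi hg
    refine norm_le_of_backward_of_le (g := fun x => (zeroRest μ w lam x).mulVec (Z x) i) hM
      (hst.hasDerivAt i) (hst.nonneg i) (fun x _ => hZ x i) (fun x hx => ?_) (hD i)
    exact (hg x hx).trans (le_mul_of_one_le_right hM hi)
  have hK0 : 0 ≤ K := by linarith
  have hmul : ∀ {p q : ℂ} {s t : ℝ}, ‖p‖ ≤ s → ‖q‖ ≤ t → ‖p * q‖ ≤ s * t := by
    intro p q s t hp hq
    rw [norm_mul]
    exact mul_le_mul hp hq (norm_nonneg _) ((norm_nonneg _).trans hp)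
  have hE : ∀ x, x₀ ≤ x → ‖(Real.exp (-x) : ℂ)‖ ≤ 1 := by
    intro x hx
    have := (hx₀ x hx).2.2
    rw [Complex.norm_real, Real.norm_of_nonneg (Real.exp_nonneg _), Real.exp_le_one_iff]
    linarith
  have hrest : ∀ x i, (zeroRest μ w lam x).mulVec (Z x) i = (Real.exp (-x) : ℂ) *
      (zeroPerturbation (regPlus μ w lam (Real.exp (-x))) (regMinus μ w lam (Real.exp (-x)))
        (2 * (w (Real.exp (-x)) : ℂ) ^ 2)).mulVec (Z x) i := by
    intro x i
    rw [zeroRest, Matrix.smul_mulVec, Pi.smul_apply, smul_eq_mul]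
  have hw0 : ∀ x, x₀ ≤ x → ‖Z x 0‖ ≤ 1 := fun x hx => by
    simpa [zeroWeight] using (hx₀ x hx).2.1 0
  have hw1 : ∀ x, x₀ ≤ x → ‖(Real.exp (-x) : ℂ) * Z x 1‖ ≤ 1 := fun x hx => by
    simpa [zeroWeight] using (hx₀ x hx).2.1 1
  have hw2 : ∀ x, x₀ ≤ x → ‖(Real.exp (-x) : ℂ) * Z x 2‖ ≤ 1 := fun x hx => by
    simpa [zeroWeight] using (hx₀ x hx).2.1 2
  have hw4 : ∀ x, x₀ ≤ x → ‖(Real.exp (-x) : ℂ) * Z x 4‖ ≤ 1 := fun x hx => by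
    simpa [zeroWeight] using (hx₀ x hx).2.1 4
  have hw5 : ∀ x, x₀ ≤ x → ‖(Real.exp (-x) : ℂ) * Z x 5‖ ≤ 1 := fun x hx => by
    simpa [zeroWeight] using (hx₀ x hx).2.1 5
  -- Coordinate `3` has to come first: its forcing contains only `r Z₁`, `r Z₂`, `r Z₄`, `r Z₅`,
  -- each already at most `1`, with coefficients at most `K`.
  have hb3 : ∀ x, x₀ ≤ x → ‖Z x 3‖ ≤ 4 * K := by
    refine hboot 3 _ (by positivity) (by simp [zeroRate]; linarith) fun x hx => ?_
    obtain ⟨⟨h1, h2, hc⟩, -, -⟩ := hx₀ x hx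
    rw [hrest, zeroPerturbation_mulVec]
    set r : ℂ := (Real.exp (-x) : ℂ)
    set k₁ := regPlus μ w lam (Real.exp (-x))
    set k₂ := regMinus μ w lam (Real.exp (-x))
    set c : ℂ := 2 * (w (Real.exp (-x)) : ℂ) ^ 2
    have e : r * ![-Z x 1 - Z x 2, -k₂ * Z x 0 - Z x 3, -k₁ * Z x 0 - Z x 3,
        -k₁ * Z x 1 - k₂ * Z x 2 + c * Z x 4 - c * Z x 5, -c * Z x 0, c * Z x 0] 3 =
        -(k₁ * (r * Z x 1)) - k₂ * (r * Z x 2) + c * (r * Z x 4) - c * (r * Z x 5) := by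
      simp
      ring
    rw [e]
    have i1 := hmul h1 (hw1 x hx)
    have i2 := hmul h2 (hw2 x hx)
    have i4 := hmul hc (hw4 x hx)
    have i5 := hmul hc (hw5 x hx)
    refine (norm_sub_le _ _).trans ?_
    have j1 := norm_add_le (-(k₁ * (r * Z x 1)) - k₂ * (r * Z x 2)) (c * (r * Z x 4))
    have j2 := norm_sub_le (-(k₁ * (r * Z x 1))) (k₂ * (r * Z x 2))
    rw [norm_neg] at j2
    linarith
  have hb45 : ∀ i : Fin 6, i = 4 ∨ i = 5 → ∀ x, x₀ ≤ x → ‖Z x i‖ ≤ 5 * K := by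
    intro i hi
    refine hboot i _ (by positivity) ?_ fun x hx => ?_
    · have : (0 : ℝ) ≤ a + b := by positivity
      rcases hi with rfl | rfl <;> simp [zeroRate] <;> linarith
    · obtain ⟨⟨h1, h2, hc⟩, -, -⟩ := hx₀ x hx
      rw [hrest, zeroPerturbation_mulVec]
      have i1 := hmul (hE x hx) (hmul hc (hw0 x hx))
      rw [show ∀ u v t : ℂ, u * (v * t) = u * v * t by intros; ring] at i1
      rcases hi with rfl | rfl
      · refine le_trans (le_of_eq ?_) (i1.trans (by linarith))
        rw [← norm_neg]
        congr 1
        simp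
        ring
      · refine le_trans (le_of_eq ?_) (i1.trans (by linarith))
        congr 1
        simp
        ring
  -- Here `Z₃` enters with a single factor `r`, while the asymptotics control only `r² Z₃`; this is
  -- where `hb3` is needed. The constant is `K + 4 K`.
  have hb12 : ∀ i : Fin 6, i = 1 ∨ i = 2 → ∀ x, x₀ ≤ x → ‖Z x i‖ ≤ 5 * K := by
    intro i hi
    refine hboot i _ (by positivity) ?_ fun x hx => ?_
    · rcases hi with rfl | rfl <;> simp [zeroRate]
    · obtain ⟨⟨h1, h2, hc⟩, -, -⟩ := hx₀ x hx
      rw [hrest, zeroPerturbation_mulVec]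
      have key : ∀ k : ℂ, ‖k‖ ≤ K → ‖(Real.exp (-x) : ℂ) * (-k * Z x 0 - Z x 3)‖ ≤ 5 * K := by
        intro k hk
        have i1 := hmul hk (hw0 x hx)
        have i2 := norm_sub_le (-k * Z x 0) (Z x 3)
        rw [neg_mul, norm_neg] at i2
        have i3 := hb3 x hx
        have i4 := hmul (hE x hx) (show ‖-(k * Z x 0) - Z x 3‖ ≤ 5 * K by linarith)
        rw [neg_mul]
        linarith
      rcases hi with rfl | rfl
      · exact key _ h2
      · exact key _ h1
  have hall : ∀ x, x₀ ≤ x → ∀ i, ‖Z x i‖ ≤ 5 * K := by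
    intro x hx i
    fin_cases i
    · exact (hw0 x hx).trans (by linarith)
    · exact hb12 1 (by simp) x hx
    · exact hb12 2 (by simp) x hx
    · exact (hb3 x hx).trans (by linarith)
    · exact hb45 4 (by simp) x hx
    · exact hb45 5 (by simp) x hx
  obtain ⟨x, hx⟩ := (hst.eventually_eq_zero (fun x _ i => hZ x i) hall hD).exists
  exact ⟨Real.exp (-x), Real.exp_pos _, eq_zero_of_zeroCoord_eq_zero (Real.exp_pos _) hx⟩

end AtZero

/-! ### The adjoint exterior system near `r = ∞`, in the variable `x = log r`. -/

section AtInfinity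

/-- The sum of the diagonal coefficients without their leading parts `r²`. -/
def coefSum (m : ℕ) (μ : ℝ) (w : ℝ → ℝ) (j : ℤ) (r : ℝ) : ℂ :=
  (((j : ℂ) + m) ^ 2 + ((j : ℂ) - m) ^ 2) / (r : ℂ) ^ 2 - 4 * μ + 8 * (w r : ℂ) ^ 2

/-- The difference of the diagonal coefficients. -/
def coefDiff (m : ℕ) (j : ℤ) (lam : ℂ) (r : ℝ) : ℂ :=
  (((j : ℂ) + m) ^ 2 - ((j : ℂ) - m) ^ 2) / (r : ℂ) ^ 2 - 4 * Complex.I * lam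

/-- In terms of sum and difference, `λ` occurs only in the difference, which enters
`infPerturbation` off the diagonal. So the leading factor `e^(-r²) r^(2μ)` is free of `λ`. -/
theorem coefPlus_eq (m : ℕ) (μ : ℝ) (w : ℝ → ℝ) (j : ℤ) (lam : ℂ) (r : ℝ) :
    coefPlus m μ w j lam r =
      (r : ℂ) ^ 2 + (coefSum m μ w j r + coefDiff m j lam r) / 2 := by
  simp only [coefPlus, kPlus, coefSum, coefDiff]
  ring

theorem coefMinus_eq (m : ℕ) (μ : ℝ) (w : ℝ → ℝ) (j : ℤ) (lam : ℂ) (r : ℝ) :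
    coefMinus m μ w j lam r =
      (r : ℂ) ^ 2 + (coefSum m μ w j r - coefDiff m j lam r) / 2 := by
  simp only [coefMinus, kMinus, coefSum, coefDiff]
  ring

/-- The rates of the diagonalized adjoint exterior system at infinity, in units of `r²`. -/
def infRate : Fin 6 → ℝ := ![0, 2, 2, 4, 2, 2]

/-- The perturbation of the diagonalized adjoint exterior system at infinity. -/
def infPerturbation (μ : ℝ) (r s t c : ℂ) : Matrix (Fin 6) (Fin 6) ℂ :=
  !![-(s / 2 + 2 * μ), (2 - s / 2) / r, t / 2 / r, 0, -c / r, c / r;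
     r * (1 + s / 4), 1 - 2 * μ, -(t / 2), 1 - s / 4, c, -c;
     -(r * (t / 4)), -(t / 2), 1 - 2 * μ, -(t / 4), 0, 0;
     0, 2 + s / 2, t / 2, 1 - 2 * μ + s / 2, -c, c;
     r * (c / 4), c / 2, 0, c / 4, 1 - 2 * μ, 0;
     -(r * (c / 4)), -(c / 2), 0, -(c / 4), 0, 1 - 2 * μ]

theorem infPerturbation_mulVec (μ : ℝ) (r s t c : ℂ) (z : Fin 6 → ℂ) :
    (infPerturbation μ r s t c).mulVec z =
      ![-(s / 2 + 2 * μ) * z 0 + (2 - s / 2) / r * z 1 + t / 2 / r * z 2 - c / r * z 4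
          + c / r * z 5,
        r * (1 + s / 4) * z 0 + (1 - 2 * μ) * z 1 - t / 2 * z 2 + (1 - s / 4) * z 3 + c * z 4
          - c * z 5,
        -(r * (t / 4)) * z 0 - t / 2 * z 1 + (1 - 2 * μ) * z 2 - t / 4 * z 3,
        (2 + s / 2) * z 1 + t / 2 * z 2 + (1 - 2 * μ + s / 2) * z 3 - c * z 4 + c * z 5,
        r * (c / 4) * z 0 + c / 2 * z 1 + c / 4 * z 3 + (1 - 2 * μ) * z 4,
        -(r * (c / 4)) * z 0 - c / 2 * z 1 - c / 4 * z 3 + (1 - 2 * μ) * z 5] := by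
  funext i
  fin_cases i <;>
    simp [infPerturbation, Matrix.mulVec, dotProduct, Fin.sum_univ_succ] <;> ring

/-- The coordinates other than the zeroth carry an extra factor `r` relative to their natural scale.
This makes row `0` of size `1 / r = exp (-x)`, hence integrable, at the cost of size `r` in the
other rows, where the rates are at least `2 r²`. -/
theorem norm_infPerturbation_le {μ r K : ℝ} {s t c : ℂ} (hK : 1 ≤ K) (hr : 1 ≤ r) (hμ : |μ| ≤ K)
    (hs : ‖s‖ ≤ K) (ht : ‖t‖ ≤ K) (hc : ‖c‖ ≤ K) (hs' : ‖s / 2 + 2 * μ‖ ≤ 4 * K / r) (k : Fin 6) :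
    ‖infPerturbation μ r s t c 0 k‖ ≤ 4 * K / r ∧
      ∀ i, i ≠ 0 → ‖infPerturbation μ r s t c i k‖ ≤ 4 * K * r := by
  have hr0 : 0 < r := by linarith
  have hrn : ‖(r : ℂ)‖ = r := by rw [Complex.norm_real, Real.norm_of_nonneg hr0.le]
  have hKr : 4 * K ≤ 4 * K * r := by nlinarith
  have s2 : ‖s / 2‖ ≤ K / 2 := by rw [norm_div]; simp; linarith
  have s4 : ‖s / 4‖ ≤ K / 4 := by rw [norm_div]; simp; linarith
  have t2 : ‖t / 2‖ ≤ K / 2 := by rw [norm_div]; simp; linarith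
  have t4 : ‖t / 4‖ ≤ K / 4 := by rw [norm_div]; simp; linarith
  have c2 : ‖c / 2‖ ≤ K / 2 := by rw [norm_div]; simp; linarith
  have c4 : ‖c / 4‖ ≤ K / 4 := by rw [norm_div]; simp; linarith
  have h2 : ‖(2 : ℂ)‖ = 2 := by simp
  have h1 : ‖(1 : ℂ)‖ = 1 := by simp
  have m2 : ‖2 * (μ : ℂ)‖ ≤ 2 * K := by rw [norm_mul]; simp; linarith
  have a1 : ‖2 - s / 2‖ ≤ 4 * K := by have := norm_sub_le (2 : ℂ) (s / 2); linarith
  have a2 : ‖1 + s / 4‖ ≤ 4 * K := by have := norm_add_le (1 : ℂ) (s / 4); linarith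
  have a3 : ‖1 - 2 * (μ : ℂ)‖ ≤ 3 * K := by have := norm_sub_le (1 : ℂ) (2 * μ); linarith
  have a4 : ‖1 - s / 4‖ ≤ 4 * K := by have := norm_sub_le (1 : ℂ) (s / 4); linarith
  have a5 : ‖2 + s / 2‖ ≤ 4 * K := by have := norm_add_le (2 : ℂ) (s / 2); linarith
  have a6 : ‖1 - 2 * (μ : ℂ) + s / 2‖ ≤ 4 * K := by
    have := norm_add_le (1 - 2 * (μ : ℂ)) (s / 2); linarith
  have hdiv : ∀ z : ℂ, ‖z‖ ≤ 4 * K → ‖z / r‖ ≤ 4 * K / r := by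
    intro z hz
    rw [norm_div, hrn]
    gcongr
  have hmul : ∀ z : ℂ, ‖z‖ ≤ 4 * K → ‖r * z‖ ≤ 4 * K * r := by
    intro z hz
    rw [norm_mul, hrn, mul_comm]
    gcongr
  have h0 : (0 : ℝ) ≤ 4 * K / r := by positivity
  have h0' : (0 : ℝ) ≤ 4 * K * r := by positivity
  constructor
  · fin_cases k
    · exact (norm_neg _).trans_le hs'
    · exact hdiv _ a1
    · exact hdiv _ (by linarith)
    · simpa [infPerturbation] using h0
    · exact hdiv _ (by rw [norm_neg]; linarith)
    · exact hdiv _ (by linarith)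
  · intro i hi
    fin_cases i
    · exact absurd rfl hi
    all_goals fin_cases k
    · exact hmul _ a2
    · exact (show ‖1 - 2 * (μ : ℂ)‖ ≤ _ by linarith)
    · exact (norm_neg (t / 2)).trans_le (by linarith)
    · exact (show ‖1 - s / 4‖ ≤ _ by linarith)
    · exact (show ‖c‖ ≤ _ by linarith)
    · exact (norm_neg c).trans_le (by linarith)
    · exact (norm_neg _).trans_le (hmul _ (by linarith))
    · exact (norm_neg (t / 2)).trans_le (by linarith)
    · exact (show ‖1 - 2 * (μ : ℂ)‖ ≤ _ by linarith)
    · exact (norm_neg (t / 4)).trans_le (by linarith)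
    · simpa [infPerturbation] using h0'
    · simpa [infPerturbation] using h0'
    · simpa [infPerturbation] using h0'
    · exact (show ‖2 + s / 2‖ ≤ _ by linarith)
    · exact (show ‖t / 2‖ ≤ _ by linarith)
    · exact (show ‖1 - 2 * (μ : ℂ) + s / 2‖ ≤ _ by linarith)
    · exact (norm_neg c).trans_le (by linarith)
    · exact (show ‖c‖ ≤ _ by linarith)
    · exact hmul _ (by linarith)
    · exact (show ‖c / 2‖ ≤ _ by linarith)
    · simpa [infPerturbation] using h0'
    · exact (show ‖c / 4‖ ≤ _ by linarith)
    · exact (show ‖1 - 2 * (μ : ℂ)‖ ≤ _ by linarith)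
    · simpa [infPerturbation] using h0'
    · exact (norm_neg _).trans_le (hmul _ (by linarith))
    · exact (norm_neg (c / 2)).trans_le (by linarith)
    · simpa [infPerturbation] using h0'
    · exact (norm_neg (c / 4)).trans_le (by linarith)
    · simpa [infPerturbation] using h0'
    · exact (show ‖1 - 2 * (μ : ℂ)‖ ≤ _ by linarith)

/-- The perturbation of the diagonalized adjoint exterior system in the variable `x = log r`. -/
def infRest (m : ℕ) (μ : ℝ) (w : ℝ → ℝ) (j : ℤ) (lam : ℂ) (x : ℝ) : Matrix (Fin 6) (Fin 6) ℂ :=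
  infPerturbation μ (Real.exp x : ℝ) (coefSum m μ w j (Real.exp x)) (coefDiff m j lam (Real.exp x))
    (2 * (w (Real.exp x) : ℂ) ^ 2)

variable {m : ℕ} {μ : ℝ} {w : ℝ → ℝ}

theorem IsVortexProfile.exists_infRest_bound (hw : IsVortexProfile m μ w) (j : ℤ) (lam : ℂ) :
    ∃ K : ℝ, 0 ≤ K ∧ ∀ᶠ x : ℝ in atTop, ∀ k,
      ‖infRest m μ w j lam x 0 k‖ ≤ K * Real.exp (-x) ∧
      ∀ i, i ≠ 0 → ‖infRest m μ w j lam x i k‖ ≤ K * Real.exp x := by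
  obtain ⟨C, hC⟩ := hw.sq_decay
  set A : ℝ := ‖((j : ℂ) + m) ^ 2‖ + ‖((j : ℂ) - m) ^ 2‖ with hA
  have hA0 : 0 ≤ A := by positivity
  set K : ℝ := 1 + A + 8 * |C| + 4 * |μ| + 4 * ‖lam‖ with hK
  have hK1 : 1 ≤ K := by
    have := abs_nonneg C; have := abs_nonneg μ; have := norm_nonneg lam; linarith
  refine ⟨4 * K, by linarith, ?_⟩
  filter_upwards [Real.tendsto_exp_atTop.eventually hC, eventually_ge_atTop 0] with x hx hx0 k
  have hr1 : 1 ≤ Real.exp x := Real.one_le_exp hx0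
  rw [Real.exp_neg, ← div_eq_mul_inv]
  have hinv : 1 / Real.exp x ^ 2 ≤ 1 / Real.exp x := by
    apply one_div_le_one_div_of_le (by positivity)
    nlinarith
  have hinv1 : 1 / Real.exp x ≤ 1 := by
    rw [div_le_one (by positivity)]; exact hr1
  have hinv0 : 0 ≤ 1 / Real.exp x ^ 2 := by positivity
  set r := Real.exp x with hr
  have hw1 : ‖(w r : ℂ) ^ 2‖ ≤ |C| * (1 / r ^ 2) := by
    rw [norm_pow, Complex.norm_real, Real.norm_eq_abs, sq_abs]
    refine hx.trans ?_
    rw [div_eq_mul_one_div]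
    gcongr
    exact le_abs_self C
  have hrn : ‖(r : ℂ) ^ 2‖ = r ^ 2 := by
    rw [norm_pow, Complex.norm_real, Real.norm_of_nonneg (by linarith)]
  have hsum : ‖(((j : ℂ) + m) ^ 2 + ((j : ℂ) - m) ^ 2) / (r : ℂ) ^ 2‖ ≤ A * (1 / r ^ 2) := by
    rw [norm_div, hrn, div_eq_mul_one_div]
    gcongr
    exact norm_add_le _ _
  have hdiff : ‖(((j : ℂ) + m) ^ 2 - ((j : ℂ) - m) ^ 2) / (r : ℂ) ^ 2‖ ≤ A * (1 / r ^ 2) := by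
    rw [norm_div, hrn, div_eq_mul_one_div]
    gcongr
    exact norm_sub_le _ _
  have h8 : ‖8 * (w r : ℂ) ^ 2‖ ≤ 8 * |C| * (1 / r ^ 2) := by
    rw [norm_mul]; norm_num at hw1 ⊢; linarith
  have hA1 : A * (1 / r ^ 2) ≤ A := mul_le_of_le_one_right hA0 (hinv.trans hinv1)
  have hC1 : 8 * |C| * (1 / r ^ 2) ≤ 8 * |C| :=
    mul_le_of_le_one_right (by positivity) (hinv.trans hinv1)
  have hm4 : ‖(4 * μ : ℂ)‖ = 4 * |μ| := by simp
  have hl4 : ‖4 * Complex.I * lam‖ = 4 * ‖lam‖ := by simp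
  have p1 := abs_nonneg C
  have p2 := abs_nonneg μ
  have p3 := norm_nonneg lam
  refine norm_infPerturbation_le hK1 hr1 (by linarith) ?_ ?_ ?_ ?_ k
  · have q1 := norm_add_le ((((j : ℂ) + m) ^ 2 + ((j : ℂ) - m) ^ 2) / (r : ℂ) ^ 2 - 4 * μ)
      (8 * (w r : ℂ) ^ 2)
    have q2 := norm_sub_le ((((j : ℂ) + m) ^ 2 + ((j : ℂ) - m) ^ 2) / (r : ℂ) ^ 2) (4 * μ)
    rw [coefSum]
    linarith
  · have q2 := norm_sub_le ((((j : ℂ) + m) ^ 2 - ((j : ℂ) - m) ^ 2) / (r : ℂ) ^ 2)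
      (4 * Complex.I * lam)
    rw [coefDiff]
    linarith
  · have : ‖2 * (w r : ℂ) ^ 2‖ = ‖8 * (w r : ℂ) ^ 2‖ / 4 := by
      rw [norm_mul, norm_mul]; norm_num; ring
    rw [this]
    linarith
  -- The power `r^(2μ)` cancels the constant part of `coefSum`, and the remainder is `O(r⁻²)` by the
  -- decay of the profile.
  · have e : coefSum m μ w j r / 2 + 2 * μ =
        ((((j : ℂ) + m) ^ 2 + ((j : ℂ) - m) ^ 2) / (r : ℂ) ^ 2 + 8 * (w r : ℂ) ^ 2) / 2 := by
      rw [coefSum]; ring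
    rw [e, norm_div]
    have q := norm_add_le ((((j : ℂ) + m) ^ 2 + ((j : ℂ) - m) ^ 2) / (r : ℂ) ^ 2)
      (8 * (w r : ℂ) ^ 2)
    have h2 : ‖(2 : ℂ)‖ = 2 := by simp
    rw [h2, div_eq_mul_one_div (4 * K)]
    have q2 : A * (1 / r ^ 2) + 8 * |C| * (1 / r ^ 2) ≤ (A + 8 * |C|) * (1 / r) := by
      rw [← add_mul]
      gcongr
    have q3 : (A + 8 * |C|) * (1 / r) ≤ 4 * K * (1 / r) := by
      gcongr
      linarith
    have q4 := norm_nonneg ((((j : ℂ) + m) ^ 2 + ((j : ℂ) - m) ^ 2) / (r : ℂ) ^ 2 +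
      8 * (w r : ℂ) ^ 2)
    linarith

theorem infRate_nonneg (i : Fin 6) : 0 ≤ infRate i := by
  fin_cases i <;> simp [infRate]

theorem two_le_infRate {i : Fin 6} (hi : i ≠ 0) : 2 ≤ infRate i := by
  fin_cases i <;> simp_all [infRate]
  norm_num

theorem IsVortexProfile.isBackwardStable_inf (hw : IsVortexProfile m μ w) (j : ℤ) (lam : ℂ) :
    IsBackwardStable (fun i x => infRate i * (Real.exp x ^ 2 / 2))
      (fun i x => infRate i * Real.exp x ^ 2) (infRest m μ w j lam) where
  hasDerivAt i x := by
    refine ((((Real.hasDerivAt_exp x).pow 2).div_const 2).const_mul (infRate i)).congr_deriv ?_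
    simp
    left
    ring
  nonneg i _ := mul_nonneg (infRate_nonneg i) (by positivity)
  continuous_diag _ := by fun_prop
  continuous_rest i k := by
    have hwc : Continuous fun x : ℝ => (w (Real.exp x) : ℂ) := Complex.continuous_ofReal.comp
      (hw.continuousOn.comp_continuous (by fun_prop) fun x => Real.exp_pos _)
    have hec : Continuous fun x : ℝ => (Real.exp x : ℂ) :=
      Complex.continuous_ofReal.comp Real.continuous_exp
    have he0 : ∀ x : ℝ, (Real.exp x : ℂ) ≠ 0 := fun x =>
      Complex.ofReal_ne_zero.2 (Real.exp_pos x).ne'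
    have he2 : ∀ x : ℝ, (Real.exp x : ℂ) ^ 2 ≠ 0 := fun x => pow_ne_zero 2 (he0 x)
    have h1 : Continuous fun x : ℝ => coefSum m μ w j (Real.exp x) := by
      unfold coefSum
      exact ((continuous_const.div (hec.pow 2) he2).sub continuous_const).add
        (continuous_const.mul (hwc.pow 2))
    have h2 : Continuous fun x : ℝ => coefDiff m j lam (Real.exp x) := by
      unfold coefDiff
      exact (continuous_const.div (hec.pow 2) he2).sub continuous_const
    have h3 : Continuous fun x : ℝ => 2 * (w (Real.exp x) : ℂ) ^ 2 :=
      continuous_const.mul (hwc.pow 2)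
    unfold infRest
    generalize hs : (fun x : ℝ => coefSum m μ w j (Real.exp x)) = s at h1
    generalize ht : (fun x : ℝ => coefDiff m j lam (Real.exp x)) = t at h2
    generalize hc : (fun x : ℝ => 2 * (w (Real.exp x) : ℂ) ^ 2) = c at h3
    generalize he : (fun x : ℝ => (Real.exp x : ℂ)) = e at hec
    have e1 : (fun x => infPerturbation μ (Real.exp x : ℝ) (coefSum m μ w j (Real.exp x))
        (coefDiff m j lam (Real.exp x)) (2 * (w (Real.exp x) : ℂ) ^ 2) i k) =
        fun x => infPerturbation μ (e x) (s x) (t x) (c x) i k := by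
      rw [← hs, ← ht, ← hc, ← he]
    have he0' : ∀ x, e x ≠ 0 := by rw [← he]; exact he0
    rw [e1]
    fin_cases i <;> fin_cases k <;> simp [infPerturbation] <;> fun_prop (disch := exact he0')
  bound i k := by
    obtain ⟨K, hK, h⟩ := hw.exists_infRest_bound j lam
    refine ⟨K, ?_⟩
    -- With rate at least `2` and `4 · 6 = 24` in the denominator, `K r ≤ 2 r² / 24` amounts to `r ≥
    -- 12 K`.
    filter_upwards [h, Real.tendsto_exp_atTop.eventually_ge_atTop (12 * K)] with x hx hxK
    have hx0 := Real.exp_pos x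
    by_cases hi : i = 0
    · subst hi
      simpa [infRate] using (hx k).1
    · refine ((hx k).2 i hi).trans ?_
      have h1 := two_le_infRate hi
      have h2 : K * Real.exp x ≤ infRate i * Real.exp x ^ 2 / (4 * (Fintype.card (Fin 6) : ℕ)) := by
        rw [le_div_iff₀ (by simp)]
        simp only [Fintype.card_fin]
        push_cast
        nlinarith [mul_le_mul_of_nonneg_right hxK hx0.le, mul_nonneg (sub_nonneg.2 h1)
          (sq_nonneg (Real.exp x))]
      have h3 : 0 ≤ K * Real.exp (-x) := by positivity
      linarith

/-- The decaying factor `e^(-r²) r^(2μ)`. -/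
def decayFactor (μ r : ℝ) : ℝ := Real.exp (-r ^ 2) * r ^ (2 * μ)

theorem decayFactor_pos (μ : ℝ) {r : ℝ} (hr : 0 < r) : 0 < decayFactor μ r :=
  mul_pos (Real.exp_pos _) (Real.rpow_pos_of_pos hr _)

theorem hasDerivAt_decayFactor (μ : ℝ) {r : ℝ} (hr : 0 < r) :
    HasDerivAt (fun s : ℝ => (decayFactor μ s : ℂ))
      ((-2 * r + 2 * μ / r) * decayFactor μ r) r := by
  have h1 : HasDerivAt (fun s : ℝ => Real.exp (-s ^ 2)) (Real.exp (-r ^ 2) * (-(2 * r))) r := by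
    simpa using ((hasDerivAt_id r).fun_pow 2).fun_neg.exp
  have h2 := Real.hasDerivAt_rpow_const (x := r) (p := 2 * μ) (Or.inl hr.ne')
  have h3 : HasDerivAt (fun s : ℝ => decayFactor μ s)
      ((-2 * r + 2 * μ / r) * decayFactor μ r) r := by
    refine (h1.mul h2).congr_deriv ?_
    rw [Real.rpow_sub hr, Real.rpow_one, decayFactor]
    field_simp
  refine h3.ofReal_comp.congr_deriv ?_
  push_cast
  ring

/-- The bivector with given coordinates in the basis that diagonalizes the adjoint exterior system
at infinity. -/
def infBivector (r φ : ℂ) (z : Fin 6 → ℂ) : Pair → ℂ :=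
  bivector (φ * (4 * z 4)) (φ * (r ^ 2 * (z 0 + z 3 * r⁻¹ - 2 * (z 1 * r⁻¹))))
    (φ * (r * (z 0 - z 3 * r⁻¹ + 2 * (z 2 * r⁻¹))))
    (φ * (r * (z 0 - z 3 * r⁻¹ - 2 * (z 2 * r⁻¹))))
    (φ * (z 0 + z 3 * r⁻¹ + 2 * (z 1 * r⁻¹))) (φ * (4 * z 5))

/-- The coordinates of a bivector in the basis that diagonalizes the adjoint exterior system
at infinity. -/
def infCoord (r η : ℂ) (u : Pair → ℂ) : Fin 6 → ℂ :=
  ![η * (u (pair 1 3) + u (pair 0 3) * r⁻¹ + u (pair 1 2) * r⁻¹ + u (pair 0 2) * (r ^ 2)⁻¹),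
    η * (r * u (pair 1 3) - u (pair 0 2) * r⁻¹),
    η * (u (pair 0 3) - u (pair 1 2)),
    η * (r * u (pair 1 3) + u (pair 0 2) * r⁻¹ - u (pair 0 3) - u (pair 1 2)),
    η * u (pair 0 1),
    η * u (pair 2 3)]

theorem eq_zero_of_infCoord_eq_zero {r η : ℂ} (hr : r ≠ 0) (hη : η ≠ 0) {u : Pair → ℂ}
    (h : infCoord r η u = 0) : u = 0 := by
  have h0 := congrFun h 0
  have h1 := congrFun h 1
  have h2 := congrFun h 2
  have h3 := congrFun h 3
  have h4 := congrFun h 4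
  have h5 := congrFun h 5
  simp [infCoord, hη] at h0 h1 h2 h3 h4 h5
  field_simp at h0 h1 h3
  have e13 : r ^ 2 * u (pair 1 3) = 0 := by
    linear_combination (h0 + 2 * h1 + h3) / 4
  have e02 : u (pair 0 2) = 0 := by
    linear_combination (h0 - 2 * h1 + h3) / 4
  have e03 : r * u (pair 0 3) = 0 := by
    linear_combination (h0 - h3) / 4 + r * h2 / 2
  have e12 : r * u (pair 1 2) = 0 := by
    linear_combination (h0 - h3) / 4 - r * h2 / 2
  simp [hr] at e13 e03 e12
  funext p
  revert p
  rw [forall_pair]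
  exact ⟨h4, e02, e03, e12, e13, h5⟩

theorem hasDerivAt_infBivector (m : ℕ) (μ : ℝ) (w : ℝ → ℝ) (j : ℤ) (lam : ℂ) {z : ℝ → Fin 6 → ℂ}
    {r : ℝ} (hr : 0 < r)
    (hz : ∀ i, HasDerivAt (fun s => z s i)
      (infRate i * r * z r i +
        (infPerturbation μ r (coefSum m μ w j r) (coefDiff m j lam r)
          (2 * (w r : ℂ) ^ 2)).mulVec (z r) i / r) r) :
    HasDerivAt (fun s : ℝ => infBivector s (decayFactor μ s) (z s))
      (-(Matrix.vecMul (infBivector r (decayFactor μ r) (z r))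
        (exteriorMatrix (B m μ w j lam r)))) r := by
  have hr' : (r : ℂ) ≠ 0 := Complex.ofReal_ne_zero.2 hr.ne'
  rw [hasDerivAt_adjoint_iff, coefPlus_eq, coefMinus_eq]
  rw [infPerturbation_mulVec] at hz
  have h0 := hz 0
  have h1 := hz 1
  have h2 := hz 2
  have h3 := hz 3
  have h4 := hz 4
  have h5 := hz 5
  simp [infRate] at h0 h1 h2 h3 h4 h5
  have hp := hasDerivAt_decayFactor μ hr
  have hid : HasDerivAt (fun s : ℝ => (s : ℂ)) 1 r := by
    simpa using (hasDerivAt_id r).ofReal_comp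
  have hi : HasDerivAt (fun s : ℝ => ((s : ℂ))⁻¹) (-1 / (r : ℂ) ^ 2) r := by
    simpa using (Complex.ofRealCLM.hasDerivAt (x := r)).fun_inv hr'
  simp only [infBivector, bivector]
  simp
  refine ⟨?_, ?_, ?_, ?_, ?_, ?_⟩
  · refine (hp.mul (h4.const_mul 4)).congr_deriv ?_
    field_simp
    ring
  · refine (hp.mul ((hid.pow 2).mul ((h0.add (h3.mul hi)).sub
      ((h1.mul hi).const_mul 2)))).congr_deriv ?_
    simp
    field_simp
    ring
  · refine (hp.mul (hid.mul ((h0.sub (h3.mul hi)).add ((h2.mul hi).const_mul 2)))).congr_deriv ?_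
    simp
    field_simp
    ring
  · refine (hp.mul (hid.mul ((h0.sub (h3.mul hi)).sub ((h2.mul hi).const_mul 2)))).congr_deriv ?_
    simp
    field_simp
    ring
  · refine (hp.mul ((h0.add (h3.mul hi)).add ((h1.mul hi).const_mul 2))).congr_deriv ?_
    simp
    field_simp
    ring
  · refine (hp.mul (h5.const_mul 4)).congr_deriv ?_
    field_simp
    ring

/-- The coordinates come from pairing with the leading growing and decaying columns `(1/r, ±1)`.
With `η = φ⁻¹`, `infCoord` is four times the inverse of `infBivector`; the factor is harmless
because the system is linear and `infCoord` serves only uniqueness. -/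
theorem hasDerivAt_infCoord (m : ℕ) (μ : ℝ) (w : ℝ → ℝ) (j : ℤ) (lam : ℂ) {V : ℝ → Pair → ℂ}
    {r : ℝ} (hr : 0 < r)
    (hV : HasDerivAt V (-(Matrix.vecMul (V r) (exteriorMatrix (B m μ w j lam r)))) r)
    (i : Fin 6) :
    HasDerivAt (fun s : ℝ => infCoord s ((decayFactor μ s : ℂ)⁻¹) (V s) i)
      (infRate i * r * infCoord r ((decayFactor μ r : ℂ)⁻¹) (V r) i +
        (infPerturbation μ r (coefSum m μ w j r) (coefDiff m j lam r)
          (2 * (w r : ℂ) ^ 2)).mulVec (infCoord r ((decayFactor μ r : ℂ)⁻¹) (V r)) i / r) r := by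
  have hr' : (r : ℂ) ≠ 0 := Complex.ofReal_ne_zero.2 hr.ne'
  have hφ : (decayFactor μ r : ℂ) ≠ 0 := Complex.ofReal_ne_zero.2 (decayFactor_pos μ hr).ne'
  rw [hasDerivAt_adjoint_iff, coefPlus_eq, coefMinus_eq] at hV
  obtain ⟨h01, h02, h03, h12, h13, h23⟩ := hV
  have hp : HasDerivAt (fun s : ℝ => ((decayFactor μ s : ℂ))⁻¹)
      ((2 * r - 2 * μ / r) * (decayFactor μ r : ℂ)⁻¹) r := by
    refine ((hasDerivAt_decayFactor μ hr).fun_inv hφ).congr_deriv ?_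
    field_simp
    ring
  have hid : HasDerivAt (fun s : ℝ => (s : ℂ)) 1 r := by
    simpa using (hasDerivAt_id r).ofReal_comp
  have hi : HasDerivAt (fun s : ℝ => ((s : ℂ))⁻¹) (-1 / (r : ℂ) ^ 2) r := by
    simpa using (Complex.ofRealCLM.hasDerivAt (x := r)).fun_inv hr'
  have hi2 : HasDerivAt (fun s : ℝ => (((s : ℂ)) ^ 2)⁻¹) (-2 / (r : ℂ) ^ 3) r := by
    refine (((Complex.ofRealCLM.hasDerivAt (x := r)).pow 2).fun_inv
      (by simpa using hr')).congr_deriv ?_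
    simp
    field_simp
  rw [infPerturbation_mulVec]
  revert i
  simp only [Fin.forall_fin_succ]
  simp [infCoord, infRate]
  refine ⟨?_, ?_, ?_, ?_, ?_, ?_⟩
  · refine (hp.mul (((h13.add (h03.mul hi)).add (h12.mul hi)).add (h02.mul hi2))).congr_deriv ?_
    simp
    field_simp
    ring
  · refine (hp.mul ((hid.mul h13).sub (h02.mul hi))).congr_deriv ?_
    simp
    field_simp
    ring
  · refine (hp.mul (h03.sub h12)).congr_deriv ?_
    simp
    field_simp
    ring
  · refine (hp.mul ((((hid.mul h13).add (h02.mul hi)).sub h03).sub h12)).congr_deriv ?_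
    simp
    field_simp
    ring
  · refine (hp.mul h01).congr_deriv ?_
    field_simp
    ring
  · refine (hp.mul h23).congr_deriv ?_
    field_simp
    ring

theorem exists_isAdjointSolutionAtInfinity (hw : IsVortexProfile m μ w) (j : ℤ) (lam : ℂ) :
    ∃ V, IsAdjointSolutionAtInfinity m μ w j lam V := by
  obtain ⟨Z, hZ, ⟨N, hN⟩, hlim⟩ := (hw.isBackwardStable_inf j lam).exists_solution
    -- In `infBivector` the rescaled coordinates `02`, `03`, `12`, `13` all have the limit of `z 0`,
    -- which must be the prescribed `1 / 4`.
    ![1 / 4, 0, 0, 0, 0, 0] (by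
      intro i _
      fin_cases i <;> simp [infRate])
  set z : ℝ → Fin 6 → ℂ := fun r => Z (Real.log r) with hz
  have hz' : ∀ r : ℝ, 0 < r → ∀ i, HasDerivAt (fun s => z s i)
      (infRate i * r * z r i +
        (infPerturbation μ r (coefSum m μ w j r) (coefDiff m j lam r)
          (2 * (w r : ℂ) ^ 2)).mulVec (z r) i / r) r := by
    intro r hr i
    have hr' : (r : ℂ) ≠ 0 := Complex.ofReal_ne_zero.2 hr.ne'
    refine ((hZ (Real.log r) i).scomp r (Real.hasDerivAt_log hr.ne')).congr_deriv ?_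
    rw [infRest, Real.exp_log hr, Complex.real_smul]
    push_cast
    field_simp
    rfl
  have hbd : ∀ i, ∀ᶠ r in atTop, ‖z r i‖ ≤ N := fun i =>
    (Real.tendsto_log_atTop.eventually_ge_atTop 0).mono fun r hr => hN _ hr i
  have hinv : Tendsto (fun r : ℝ => ((r : ℂ))⁻¹) atTop (𝓝 0) := by
    have h1 : Tendsto (fun r : ℝ => ((r⁻¹ : ℝ) : ℂ)) atTop (𝓝 ((0 : ℝ) : ℂ)) :=
      (Complex.continuous_ofReal.tendsto 0).comp tendsto_inv_atTop_zero
    simpa using h1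
  have hsm : ∀ i, Tendsto (fun r : ℝ => z r i * (r : ℂ)⁻¹) atTop (𝓝 0) := fun i => by
    have := hinv.zero_mul_isBoundedUnder_le (g := fun r => z r i) ⟨N, by simpa using hbd i⟩
    simpa only [mul_comm] using this
  have h0 : Tendsto (fun r => z r 0) atTop (𝓝 (1 / 4)) :=
    (hlim 0 (by simp [infRate])).comp Real.tendsto_log_atTop
  refine ⟨fun r => infBivector r (decayFactor μ r) (z r), fun r hr =>
    hasDerivAt_infBivector m μ w j lam hr (hz' r hr), ?_⟩
  have hdecay : ∀ r, Real.exp (-r ^ 2) * r ^ (2 * μ) = decayFactor μ r := fun _ => rfl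
  simp only [hdecay]
  rw [forall_pair]
  have hpos : ∀ᶠ r : ℝ in atTop, (r : ℂ) ≠ 0 ∧ (decayFactor μ r : ℂ) ≠ 0 :=
    (eventually_gt_atTop 0).mono fun r hr => ⟨Complex.ofReal_ne_zero.2 (ne_of_gt hr),
      Complex.ofReal_ne_zero.2 (decayFactor_pos μ hr).ne'⟩
  simp [infBivector, bivector, wedge]
  refine ⟨?_, ?_, ?_, ?_, ?_, ?_⟩
  · have := (hsm 4).const_mul 4
    rw [mul_zero] at this
    refine this.congr' ?_
    filter_upwards [hpos] with r hr
    obtain ⟨hr1, hr2⟩ := hr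
    field_simp
  · have := (h0.add (hsm 3)).sub ((hsm 1).const_mul 2)
    simp only [mul_zero, add_zero, sub_zero, one_div] at this
    refine this.congr' ?_
    filter_upwards [hpos] with r hr
    obtain ⟨hr1, hr2⟩ := hr
    field_simp
  · have := (h0.sub (hsm 3)).add ((hsm 2).const_mul 2)
    simp only [mul_zero, add_zero, sub_zero, one_div] at this
    refine this.congr' ?_
    filter_upwards [hpos] with r hr
    obtain ⟨hr1, hr2⟩ := hr
    field_simp
  · have := (h0.sub (hsm 3)).sub ((hsm 2).const_mul 2)
    simp only [mul_zero, sub_zero, one_div] at this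
    refine this.congr' ?_
    filter_upwards [hpos] with r hr
    obtain ⟨hr1, hr2⟩ := hr
    field_simp
  · have := (h0.add (hsm 3)).add ((hsm 1).const_mul 2)
    simp only [mul_zero, add_zero, one_div] at this
    refine this.congr' ?_
    filter_upwards [hpos] with r hr
    obtain ⟨hr1, hr2⟩ := hr
    field_simp
  · have := (hsm 5).const_mul 4
    rw [mul_zero] at this
    refine this.congr' ?_
    filter_upwards [hpos] with r hr
    obtain ⟨hr1, hr2⟩ := hr
    field_simp

/-- The powers of `1 / r` by which the coordinates `infCoord` have to be multiplied to be small. -/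
def infWeight : Fin 6 → ℕ := ![0, 1, 1, 1, 1, 1]

theorem tendsto_infCoord {V : ℝ → Pair → ℂ}
    (hlim : ∀ p : Pair, Tendsto (fun r : ℝ =>
      ((![r⁻¹, 1, r⁻¹, 1] p.1.1 * ![r⁻¹, 1, r⁻¹, 1] p.1.2
          / (Real.exp (-r ^ 2) * r ^ (2 * μ)) : ℝ) : ℂ) * V r p) atTop (𝓝 0)) (i : Fin 6) :
    Tendsto (fun r : ℝ => ((r : ℂ)⁻¹) ^ infWeight i *
      infCoord r ((decayFactor μ r : ℂ)⁻¹) (V r) i) atTop (𝓝 0) := by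
  have hdecay : ∀ r, Real.exp (-r ^ 2) * r ^ (2 * μ) = decayFactor μ r := fun _ => rfl
  simp only [hdecay] at hlim
  rw [forall_pair] at hlim
  simp at hlim
  obtain ⟨h01, h02, h03, h12, h13, h23⟩ := hlim
  have hpos : ∀ᶠ r : ℝ in atTop, (r : ℂ) ≠ 0 ∧ (decayFactor μ r : ℂ) ≠ 0 :=
    (eventually_gt_atTop 0).mono fun r hr => ⟨Complex.ofReal_ne_zero.2 (ne_of_gt hr),
      Complex.ofReal_ne_zero.2 (decayFactor_pos μ hr).ne'⟩
  revert i
  simp only [Fin.forall_fin_succ]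
  simp [infCoord, infWeight]
  refine ⟨?_, ?_, ?_, ?_, ?_, ?_⟩
  · have := ((h13.add h03).add h12).add h02
    simp only [add_zero] at this
    refine this.congr' ?_
    filter_upwards [hpos] with r hr
    obtain ⟨hr1, hr2⟩ := hr
    field_simp
  · have := h13.sub h02
    simp only [sub_zero] at this
    refine this.congr' ?_
    filter_upwards [hpos] with r hr
    obtain ⟨hr1, hr2⟩ := hr
    field_simp
  · have := h03.sub h12
    simp only [sub_zero] at this
    refine this.congr' ?_
    filter_upwards [hpos] with r hr
    obtain ⟨hr1, hr2⟩ := hr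
    field_simp
  · have := ((h13.add h02).sub h03).sub h12
    simp only [sub_zero, add_zero] at this
    refine this.congr' ?_
    filter_upwards [hpos] with r hr
    obtain ⟨hr1, hr2⟩ := hr
    field_simp
  · refine h01.congr' ?_
    filter_upwards [hpos] with r hr
    obtain ⟨hr1, hr2⟩ := hr
    field_simp
  · refine h23.congr' ?_
    filter_upwards [hpos] with r hr
    obtain ⟨hr1, hr2⟩ := hr
    field_simp

theorem exists_eq_zero_near_infinity (hw : IsVortexProfile m μ w) (j : ℤ) (lam : ℂ)
    {V : ℝ → Pair → ℂ}
    (hV : ∀ r : ℝ, 0 < r →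
      HasDerivAt V (-(Matrix.vecMul (V r) (exteriorMatrix (B m μ w j lam r)))) r)
    (hlim : ∀ p : Pair, Tendsto (fun r : ℝ =>
      ((![r⁻¹, 1, r⁻¹, 1] p.1.1 * ![r⁻¹, 1, r⁻¹, 1] p.1.2
          / (Real.exp (-r ^ 2) * r ^ (2 * μ)) : ℝ) : ℂ) * V r p) atTop (𝓝 0)) :
    ∃ r : ℝ, 0 < r ∧ V r = 0 := by
  set Z : ℝ → Fin 6 → ℂ := fun x =>
    infCoord (Real.exp x : ℝ) ((decayFactor μ (Real.exp x) : ℂ)⁻¹) (V (Real.exp x)) with hZdef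
  have hZ : ∀ x i, HasDerivAt (fun s => Z s i)
      ((infRate i * Real.exp x ^ 2 : ℝ) * Z x i + (infRest m μ w j lam x).mulVec (Z x) i) x := by
    intro x i
    have hr := Real.exp_pos x
    have h1 := hasDerivAt_infCoord m μ w j lam hr (hV _ hr) i
    refine (h1.scomp x (Real.hasDerivAt_exp x)).congr_deriv ?_
    have hr' : (Real.exp x : ℂ) ≠ 0 := Complex.ofReal_ne_zero.2 hr.ne'
    rw [infRest, Complex.real_smul]
    simp only [hZdef, Complex.ofReal_mul, Complex.ofReal_pow]
    field_simp
  have hL : ∀ i, Tendsto (fun x => ((Real.exp x : ℂ)⁻¹) ^ infWeight i * Z x i) atTop (𝓝 0) :=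
    fun i => (tendsto_infCoord hlim i).comp Real.tendsto_exp_atTop
  have hD : ∀ i, Tendsto (fun x => (Real.exp (-(infRate i * (Real.exp x ^ 2 / 2))) : ℂ) * Z x i)
      atTop (𝓝 0) := by
    intro i
    by_cases hi : i = 0
    · subst hi
      simpa [infRate, infWeight] using hL 0
    · have hwi : infWeight i = 1 := by
        fin_cases i <;> first | exact absurd rfl hi | rfl
      refine squeeze_zero_norm' ?_ (tendsto_zero_iff_norm_tendsto_zero.1 (hL i))
      filter_upwards with x
      rw [norm_mul, norm_mul]
      refine mul_le_mul_of_nonneg_right ?_ (norm_nonneg _)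
      have hr := Real.exp_pos x
      rw [hwi, pow_one, norm_inv, Complex.norm_real, Complex.norm_real,
        Real.norm_of_nonneg (Real.exp_nonneg _), Real.norm_of_nonneg hr.le, Real.exp_neg]
      apply inv_anti₀ hr
      -- With `r = exp x`, this gives `exp (Dᵢ) ≥ 1 + r² ≥ r`, so the decay of `Zᵢ / r` implies that
      -- of `exp (-Dᵢ) Zᵢ`.
      have h1 : Real.exp x ^ 2 ≤ infRate i * (Real.exp x ^ 2 / 2) := by
        nlinarith [two_le_infRate hi, sq_nonneg (Real.exp x)]
      have h2 := Real.add_one_le_exp (infRate i * (Real.exp x ^ 2 / 2))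
      nlinarith
  obtain ⟨K, hK, hKb⟩ := hw.exists_infRest_bound j lam
  have hL1 : ∀ᶠ x in atTop, ∀ i, ‖((Real.exp x : ℂ)⁻¹) ^ infWeight i * Z x i‖ ≤ 1 :=
    eventually_all.2 fun i => ((hL i).norm.eventually_lt_const (by simp)).mono fun _ h => h.le
  obtain ⟨x₀, hx₀⟩ := eventually_atTop.1 (hKb.and (hL1.and (eventually_ge_atTop 0)))
  have hst := hw.isBackwardStable_inf j lam
  have h0 : ∀ x, x₀ ≤ x → ‖Z x 0‖ ≤ 1 := fun x hx => by
    simpa [infWeight] using (hx₀ x hx).2.1 0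
  have hgrow : ∀ x, x₀ ≤ x → ∀ i, ‖Z x i‖ ≤ Real.exp x := by
    intro x hx i
    have hr := Real.exp_pos x
    by_cases hi : i = 0
    · subst hi
      exact (h0 x hx).trans (Real.one_le_exp (hx₀ x hx).2.2)
    · have hwi : infWeight i = 1 := by
        fin_cases i <;> first | exact absurd rfl hi | rfl
      have := (hx₀ x hx).2.1 i
      rw [hwi, pow_one, norm_mul, norm_inv, Complex.norm_real, Real.norm_of_nonneg hr.le,
        inv_mul_le_iff₀ hr, mul_one] at this
      exact this
  -- One bootstrap suffices here: six entries of size `K r` acting on `‖Z‖ ≤ r` give forcing `6 K r²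
  -- = 3 K · 2 r² ≤ 3 K dᵢ`.
  have hall : ∀ x, x₀ ≤ x → ∀ i, ‖Z x i‖ ≤ 1 + 3 * K := by
    intro x hx i
    by_cases hi : i = 0
    · subst hi
      exact (h0 x hx).trans (by linarith)
    · refine (norm_le_of_backward_of_le (M := 3 * K)
        (g := fun x => (infRest m μ w j lam x).mulVec (Z x) i) (by positivity)
        (hst.hasDerivAt i) (hst.nonneg i) (fun x _ => hZ x i) (fun y hy => ?_) (hD i) x hx).trans
        (by linarith)
      have h1 : ∑ k, ‖infRest m μ w j lam y i k‖ ≤ 6 * (K * Real.exp y) := by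
        refine (Finset.sum_le_sum fun k _ => ((hx₀ y hy).1 k).2 i hi).trans ?_
        simp
      calc ‖(infRest m μ w j lam y).mulVec (Z y) i‖
          ≤ (∑ k, ‖infRest m μ w j lam y i k‖) * Real.exp y := norm_mulVec_le _ (hgrow y hy) i
        _ ≤ 6 * (K * Real.exp y) * Real.exp y := by gcongr
        _ = 3 * K * (2 * Real.exp y ^ 2) := by ring
        _ ≤ _ := by
          gcongr
          exact two_le_infRate hi
  obtain ⟨x, hx⟩ := (hst.eventually_eq_zero (fun x _ i => hZ x i) hall hD).exists
  have hr := Real.exp_pos x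
  exact ⟨Real.exp x, hr, eq_zero_of_infCoord_eq_zero (Complex.ofReal_ne_zero.2 hr.ne')
    (inv_ne_zero (Complex.ofReal_ne_zero.2 (decayFactor_pos μ hr).ne')) hx⟩

end AtInfinity

/-! ### The Evans value: existence, uniqueness and symmetries. -/

section Evans

variable {m : ℕ} {μ : ℝ} {w : ℝ → ℝ} {j : ℤ} {lam : ℂ}

theorem IsSolutionAtZero.exists_eq (hw : IsVortexProfile m μ w) {U U' : ℝ → Pair → ℂ}
    (hU : IsSolutionAtZero m μ w j lam U) (hU' : IsSolutionAtZero m μ w j lam U') :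
    ∃ r : ℝ, 0 < r ∧ U r = U' r := by
  obtain ⟨r, hr, h⟩ := exists_eq_zero_near_zero hw j lam (U := fun r => U r - U' r)
    (fun r hr => ((hU.ode r hr).sub (hU'.ode r hr)).congr_deriv (Matrix.mulVec_sub _ _ _).symm)
    (fun p => by
      simpa only [Pi.sub_apply, mul_sub, sub_self] using
        (hU.asymptotics p).sub (hU'.asymptotics p))
  exact ⟨r, hr, sub_eq_zero.1 h⟩

theorem IsAdjointSolutionAtInfinity.exists_eq (hw : IsVortexProfile m μ w) {V V' : ℝ → Pair → ℂ}
    (hV : IsAdjointSolutionAtInfinity m μ w j lam V)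
    (hV' : IsAdjointSolutionAtInfinity m μ w j lam V') : ∃ r : ℝ, 0 < r ∧ V r = V' r := by
  obtain ⟨r, hr, h⟩ := exists_eq_zero_near_infinity hw j lam (V := fun r => V r - V' r)
    (fun r hr => ((hV.ode r hr).sub (hV'.ode r hr)).congr_deriv (by
      rw [Matrix.sub_vecMul]
      abel))
    (fun p => by
      simpa only [Pi.sub_apply, mul_sub, sub_self] using
        (hV.asymptotics p).sub (hV'.asymptotics p))
  exact ⟨r, hr, sub_eq_zero.1 h⟩

theorem exists_isEvansValue (hw : IsVortexProfile m μ w) (j : ℤ) (lam : ℂ) :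
    ∃ e, IsEvansValue m μ w j lam e := by
  obtain ⟨U, hU⟩ := exists_isSolutionAtZero hw j lam
  obtain ⟨V, hV⟩ := exists_isAdjointSolutionAtInfinity hw j lam
  exact ⟨dotProduct (V 1) (U 1), U, V, hU, hV, fun r hr =>
    pairing_eq m μ w j lam hU.ode hV.ode hr one_pos⟩

/-- Agreement of `U`, `U'` at one point `r` and of `V`, `V'` at one point `s` is enough: the
constant mixed pairing `V' · U'`, `V · U'` links the two values without any uniqueness theorem for
the differential equations. -/
theorem IsEvansValue.unique (hw : IsVortexProfile m μ w) {e e' : ℂ}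
    (h : IsEvansValue m μ w j lam e) (h' : IsEvansValue m μ w j lam e') : e = e' := by
  obtain ⟨U, V, hU, hV, he⟩ := h
  obtain ⟨U', V', hU', hV', he'⟩ := h'
  obtain ⟨r, hr, hUr⟩ := hU.exists_eq hw hU'
  obtain ⟨s, hs, hVs⟩ := hV.exists_eq hw hV'
  rw [← he r hr, hUr, pairing_eq m μ w j lam hU'.ode hV.ode hr hs, hVs, he' s hs]

theorem isEvansValue_iff (hw : IsVortexProfile m μ w) (j : ℤ) (lam e : ℂ) :
    IsEvansValue m μ w j lam e ↔ e = evansFunction m μ w j lam := by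
  have hex := exists_isEvansValue hw j lam
  have hval : IsEvansValue m μ w j lam (evansFunction m μ w j lam) := by
    rw [evansFunction, dif_pos hex]
    exact hex.choose_spec
  exact ⟨fun h => h.unique hw hval, fun h => h ▸ hval⟩

theorem conj_coefPlus (m : ℕ) (μ : ℝ) (w : ℝ → ℝ) (j : ℤ) (lam : ℂ) (r : ℝ) :
    conj (coefPlus m μ w j lam r) = coefPlus m μ w j (-conj lam) r := by
  simp [coefPlus, kPlus, map_ofNat]

theorem conj_coefMinus (m : ℕ) (μ : ℝ) (w : ℝ → ℝ) (j : ℤ) (lam : ℂ) (r : ℝ) :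
    conj (coefMinus m μ w j lam r) = coefMinus m μ w j (-conj lam) r := by
  simp [coefMinus, kMinus, map_ofNat]

theorem coefPlus_neg (m : ℕ) (μ : ℝ) (w : ℝ → ℝ) (j : ℤ) (lam : ℂ) (r : ℝ) :
    coefPlus m μ w (-j) (-lam) r = coefMinus m μ w j lam r := by
  simp only [coefPlus, coefMinus, kPlus, kMinus]
  push_cast
  ring

theorem coefMinus_neg (m : ℕ) (μ : ℝ) (w : ℝ → ℝ) (j : ℤ) (lam : ℂ) (r : ℝ) :
    coefMinus m μ w (-j) (-lam) r = coefPlus m μ w j lam r := by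
  simp only [coefPlus, coefMinus, kPlus, kMinus]
  push_cast
  ring

theorem IsSolutionAtZero.conj {U : ℝ → Pair → ℂ} (hU : IsSolutionAtZero m μ w j lam U) :
    IsSolutionAtZero m μ w j (-conj lam) (fun r p => conj (U r p)) where
  ode r hr := by
    have h := hU.ode r hr
    rw [hasDerivAt_exterior_iff] at h ⊢
    obtain ⟨h1, h2, h3, h4, h5, h6⟩ := h
    rw [← conj_coefPlus, ← conj_coefMinus]
    refine ⟨h1.star.congr_deriv ?_, h2.star.congr_deriv ?_, h3.star.congr_deriv ?_,
      h4.star.congr_deriv ?_, h5.star.congr_deriv ?_, h6.star.congr_deriv ?_⟩ <;> simp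
  asymptotics p := by
    have h := ((Complex.continuous_conj.tendsto _).comp (hU.asymptotics p))
    convert h using 2
    · simp only [Function.comp_apply, map_mul, Complex.conj_ofReal]
    · revert p
      rw [forall_pair]
      simp [wedge]

theorem IsAdjointSolutionAtInfinity.conj {V : ℝ → Pair → ℂ}
    (hV : IsAdjointSolutionAtInfinity m μ w j lam V) :
    IsAdjointSolutionAtInfinity m μ w j (-conj lam) (fun r p => conj (V r p)) where
  ode r hr := by
    have h := hV.ode r hr
    rw [hasDerivAt_adjoint_iff] at h ⊢
    obtain ⟨h1, h2, h3, h4, h5, h6⟩ := h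
    rw [← conj_coefPlus, ← conj_coefMinus]
    refine ⟨h1.star.congr_deriv ?_, h2.star.congr_deriv ?_, h3.star.congr_deriv ?_,
      h4.star.congr_deriv ?_, h5.star.congr_deriv ?_, h6.star.congr_deriv ?_⟩ <;> simp
  asymptotics p := by
    have h := ((Complex.continuous_conj.tendsto _).comp (hV.asymptotics p))
    convert h using 2
    · simp only [Function.comp_apply, map_mul, Complex.conj_ofReal]
    · revert p
      rw [forall_pair]
      simp [wedge, map_ofNat]

theorem IsEvansValue.conj {e : ℂ} (h : IsEvansValue m μ w j lam e) :
    IsEvansValue m μ w j (-conj lam) (conj e) := by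
  obtain ⟨U, V, hU, hV, he⟩ := h
  refine ⟨_, _, hU.conj, hV.conj, fun r hr => ?_⟩
  rw [← he r hr]
  simp [dotProduct]

/-- The negative of the map that exchange of the first and last two coordinates of `ℂ⁴`
induces on `Λ² ℂ⁴`. -/
def swapBivector (u : Pair → ℂ) : Pair → ℂ :=
  bivector (-u (pair 2 3)) (u (pair 0 2)) (u (pair 1 2)) (u (pair 0 3)) (u (pair 1 3))
    (-u (pair 0 1))

theorem swapBivector_apply (u : Pair → ℂ) :
    swapBivector u (pair 0 1) = -u (pair 2 3) ∧ swapBivector u (pair 0 2) = u (pair 0 2) ∧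
    swapBivector u (pair 0 3) = u (pair 1 2) ∧ swapBivector u (pair 1 2) = u (pair 0 3) ∧
    swapBivector u (pair 1 3) = u (pair 1 3) ∧ swapBivector u (pair 2 3) = -u (pair 0 1) :=
  ⟨rfl, rfl, rfl, rfl, rfl, rfl⟩

/-- Under `j ↦ -j` the exponents `a` and `b` trade places. Exchanging the two factors of the leading
bivector costs a sign, which the minus sign in `swapBivector` restores. -/
theorem IsSolutionAtZero.swap {U : ℝ → Pair → ℂ} (hU : IsSolutionAtZero m μ w j lam U) :
    IsSolutionAtZero m μ w (-j) (-lam) (fun r => swapBivector (U r)) where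
  ode r hr := by
    have h := hU.ode r hr
    rw [hasDerivAt_exterior_iff] at h ⊢
    obtain ⟨h1, h2, h3, h4, h5, h6⟩ := h
    rw [coefPlus_neg, coefMinus_neg]
    simp only [swapBivector_apply]
    refine ⟨h6.fun_neg.congr_deriv ?_, h2.congr_deriv ?_, h4.congr_deriv ?_, h3.congr_deriv ?_,
      h5.congr_deriv ?_, h1.fun_neg.congr_deriv ?_⟩ <;> ring
  asymptotics := by
    have h := hU.asymptotics
    have e1 : (-j + m).natAbs = (j - m).natAbs := by
      rw [← Int.natAbs_neg (j - m)]
      congr 1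
      ring
    have e2 : (-j - m).natAbs = (j + m).natAbs := by
      rw [← Int.natAbs_neg (j + m)]
      congr 1
      ring
    rw [e1, e2, add_comm (j - m).natAbs]
    rw [forall_pair] at h ⊢
    simp only [swapBivector_apply]
    obtain ⟨h1, h2, h3, h4, h5, h6⟩ := h
    refine ⟨?_, ?_, ?_, ?_, ?_, ?_⟩
    · simpa [wedge] using h6.neg
    · simpa [wedge] using h2
    · simpa [wedge] using h4
    · simpa [wedge] using h3
    · simpa [wedge, mul_comm] using h5
    · simpa [wedge] using h1.neg

theorem IsAdjointSolutionAtInfinity.swap {V : ℝ → Pair → ℂ}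
    (hV : IsAdjointSolutionAtInfinity m μ w j lam V) :
    IsAdjointSolutionAtInfinity m μ w (-j) (-lam) (fun r => swapBivector (V r)) where
  ode r hr := by
    have h := hV.ode r hr
    rw [hasDerivAt_adjoint_iff] at h ⊢
    obtain ⟨h1, h2, h3, h4, h5, h6⟩ := h
    rw [coefPlus_neg, coefMinus_neg]
    simp only [swapBivector_apply]
    refine ⟨h6.fun_neg.congr_deriv ?_, h2.congr_deriv ?_, h4.congr_deriv ?_, h3.congr_deriv ?_,
      h5.congr_deriv ?_, h1.fun_neg.congr_deriv ?_⟩ <;> ring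
  asymptotics := by
    have h := hV.asymptotics
    rw [forall_pair] at h ⊢
    simp only [swapBivector_apply]
    obtain ⟨h1, h2, h3, h4, h5, h6⟩ := h
    refine ⟨?_, ?_, ?_, ?_, ?_, ?_⟩
    · simpa [wedge] using h6.neg
    · simpa [wedge] using h2
    · simpa [wedge] using h4
    · simpa [wedge] using h3
    · simpa [wedge] using h5
    · simpa [wedge] using h1.neg

/-- `swapBivector` is a signed permutation of coordinates, so applying it to both factors preserves
the pairing. -/
theorem IsEvansValue.swap {e : ℂ} (h : IsEvansValue m μ w j lam e) :
    IsEvansValue m μ w (-j) (-lam) e := by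
  obtain ⟨U, V, hU, hV, he⟩ := h
  refine ⟨_, _, hU.swap, hV.swap, fun r hr => ?_⟩
  rw [← he r hr]
  simp only [dotProduct, sum_pair, swapBivector_apply]
  ring

end Evans

theorem conj_evansFunction {m : ℕ} {μ : ℝ} {w : ℝ → ℝ} (hw : IsVortexProfile m μ w) (j : ℤ)
    (lam : ℂ) : conj (evansFunction m μ w j lam) = evansFunction m μ w j (-conj lam) :=
  (isEvansValue_iff hw _ _ _).1 ((isEvansValue_iff hw _ _ _).2 rfl).conj

theorem evansFunction_swap {m : ℕ} {μ : ℝ} {w : ℝ → ℝ} (hw : IsVortexProfile m μ w) (j : ℤ)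
    (lam : ℂ) : evansFunction m μ w j lam = evansFunction m μ w (-j) (-lam) :=
  (isEvansValue_iff hw _ _ _).1 ((isEvansValue_iff hw _ _ _).2 rfl).swap

end

theorem proposition5p1 (m : ℕ) (hm : 1 ≤ m) (μ : ℝ) (w : ℝ → ℝ)
    (hw : IsVortexProfile m μ w) :
    (∀ (j : ℤ) (lam e : ℂ), IsEvansValue m μ w j lam e ↔ e = evansFunction m μ w j lam) ∧
    (∀ (j : ℤ) (lam : ℂ),
      conj (evansFunction m μ w j lam) = evansFunction m μ w j (-conj lam)) ∧
    (∀ (j : ℤ) (lam : ℂ),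
      evansFunction m μ w j lam = evansFunction m μ w (-j) (-lam)) ∧
    (∀ (j : ℤ) (lam : ℂ), lam.re = 0 → (evansFunction m μ w j lam).im = 0) ∧
    (∀ lam : ℂ,
      evansFunction m μ w 0 lam = evansFunction m μ w 0 (-lam) ∧
      evansFunction m μ w 0 (-lam) = conj (evansFunction m μ w 0 (conj lam))) := by
  refine ⟨isEvansValue_iff hw, conj_evansFunction hw, evansFunction_swap hw,
    fun j lam hlam => ?_, fun lam => ⟨?_, ?_⟩⟩
  -- For purely imaginary `λ` one has `-conj λ = λ`, so the value is its own conjugate.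
  · rw [← Complex.conj_eq_iff_im, conj_evansFunction hw]
    congr 1
    apply Complex.ext <;> simp [hlam]
  · simpa using evansFunction_swap hw 0 lam
  · rw [conj_evansFunction hw, Complex.conj_conj]
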